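/- **Setting.** Let $M$ be a smooth manifold of dimension $n+1$ and $\pi:M\to\mathbb R$ a fibration, i.e. a smooth surjective submersion. Adapted coordinates on $M$ are coordinates $(t,q^i)$, $1\le i\le n$, whose first coordinate is $\pi$; put $\eta=\pi^*dt$. A local section of $\pi$ is a smooth map $\sigma:U\to M$, $U\subset\mathbb R$ open, with $\pi\circ\sigma=\mathrm{id}_U$. - $J^1\pi=\{v\in TM:\eta(v)=1\}$ is the manifold of $1$-jets of local sections of $\pi$, with coordinates $(t,q^i,\dot q^i)$, projection $\pi_1:J^1\pi\to\mathbb R$, and $\eta_1=\pi_1^*dt$. For a local section $\sigma$ of $\pi$, $j^1\sigma:U\to J^1\pi$ is its velocity. - $V^*\pi$ is the dual of the vertical bundle $V\pi=\ker T\pi$, with coordinates $(t,q^i,p_i)$; $\pi_1^*:V^*\pi\to\mathbb R$ is the induced fibration, and $J^1\pi_1^*$ is its $1$-jet manifold, with coordinates $(t,q^i,p_i;\dot q^i,\dot p_i)$. - $A_\pi:J^1\pi_1^*\to T^*(J^1\pi)/\langle\eta_1\rangle$ is the bijection given in adapted coordinates by $$A_\pi(t,q^i,p_i;\dot q^i,\dot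 p_i)=(t,q^i,\dot q^i;\;p_{q^i}=\dot p_i,\;p_{\dot q^i}=p_i),$$ where $(p_{q^i},p_{\dot q^i})$ denotes the class of $p_{q^i}dq^i+p_{\dot q^i}d\dot q^i$ modulo $\eta_1$; it does not depend on the coordinates. - $J^1\pi_1^*$ carries the Poisson structure $\Lambda=\frac{\partial}{\partial q^i}\wedge\frac{\partial}{\partial\dot p_i}+\frac{\partial}{\partial\dot q^i}\wedge\frac{\partial}{\partial p_i}$, with $\Lambda^\sharp(\alpha)=\Lambda(\alpha,\cdot)$. A submanifold $C$ is Lagrangian if at each $x\in C$ one has $\Lambda(\alpha,\beta)=0$ for all $\alpha,\beta\in(\Lambda^\sharp)^{-1}(T_xC)$ and $\dim(T_xC\cap\operatorname{im}\Lambda^\sharp_x)=\frac12\dim\operatorname{im}\Lambda^\sharp_x$. Let $L:J^1\pi\to\mathbb R$ be smooth. Let $\widetilde{dL}:J^1\pi\to T^*(J^1\pi)/\langle\eta_1\rangle$ be the section induced by $dL$, let $leg_L:J^1\pi\to V^*\pi$ be the fibre derivative of $L$, locally $(t,q^i,\dot q^i)\mapsto(t,q^i,\partial L/\partial\dot q^i)$,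 and let $S_L=A_\pi^{-1}(\widetilde{dL}(J^1\pi))\subset J^1\pi_1^*$. A local section $\sigma$ of $\pi$ is a solution of the Euler–Lagrange equations for $L$ if, in all adapted coordinates, $$\frac{d}{dt}\Big(\frac{\partial L}{\partial\dot q^i}\circ j^1\sigma\Big)=\frac{\partial L}{\partial q^i}\circ j^1\sigma ,\qquad 1\le i\le n .$$ **Theorem.** 1. A local section $\sigma$ of $\pi$ is a solution of the Euler–Lagrange equations for $L$ if and only if $$A_\pi^{-1}\circ\widetilde{dL}\circ j^1\sigma=j^1(leg_L\circ j^1\sigma)$$ on the domain of $\sigma$. 2. The local equations which define $S_L$ as a Lagrangian submanifold of the Poisson manifold $(J^1\pi_1^*,\Lambda)$ are the Euler–Lagrange equations for $L$. That is: (a) in every system of adapted coordinates, a point of $J^1\pi_1^*$ over the coordinate domain lies in $S_L$ if and only if $$p_i=\frac{\partial L}{\partial\dot q^i}(t,q,\dot q),\qquad \dot p_i=\frac{\partial L}{\partial q^i}(t,q,\dot q),\qquad 1\le i\le n ;$$ the map $\big(p_i-\partial L/\partial\dot q^i,\ \dot p_i-\partial L/\partial q^i\big)$ is smooth with everywhere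 surjective differential (so that $S_L$ is a submanifold, whose tangent spaces are the kernels of this differential), and these tangent spaces are Lagrangian for $\Lambda$; (b) a local section $\tau$ of $\pi_1^*$ satisfies $j^1\tau(t)\in S_L$ for all $t$ in its domain if and only if the local section $\sigma$ of $\pi$ underlying $\tau$ is a solution of the Euler–Lagrange equations for $L$ and $\tau=leg_L\circ j^1\sigma$. -/

import Mathlib

open scoped Manifold ContDiff Topology

noncomputable section

namespace Tulczyjew

variable {F : Type*} [NormedAddCommGroup F] [NormedSpace ℝ F]

/-- A fibration `π : M → ℝ` of a manifold `M` of dimension `dim F + 1`: a smooth surjective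
submersion. -/
structure Fibration (F : Type*) [NormedAddCommGroup F] [NormedSpace ℝ F]
    (M : Type*) [TopologicalSpace M] [ChartedSpace (ℝ × F) M] where
  toFun : M → ℝ
  contMDiff : ContMDiff 𝓘(ℝ, ℝ × F) 𝓘(ℝ, ℝ) ∞ toFun
  surjective : Function.Surjective toFun
  submersion : ∀ x, Function.Surjective (mfderiv 𝓘(ℝ, ℝ × F) 𝓘(ℝ, ℝ) toFun x)

variable {M : Type*} [TopologicalSpace M] [ChartedSpace (ℝ × F) M]

instance : CoeFun (Fibration F M) (fun _ => M → ℝ) := ⟨Fibration.toFun⟩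

/-- The one-form `η = π^*(dt)` on `M`. -/
def Fibration.eta (π : Fibration F M) (x : M) : TangentSpace 𝓘(ℝ, ℝ × F) x →L[ℝ] ℝ :=
  mfderiv 𝓘(ℝ, ℝ × F) 𝓘(ℝ, ℝ) π x

theorem Fibration.eta_surjective (π : Fibration F M) (x : M) :
    Function.Surjective (π.eta x) := π.submersion x

/-- A chart of the smooth structure of `M` that is adapted to `π`: it has the form `(t, q)` with
`t = π`. -/
structure AdaptedChart (π : Fibration F M) where
  chart : OpenPartialHomeomorph M (ℝ × F)
  mem_maximalAtlas : chart ∈ IsManifold.maximalAtlas 𝓘(ℝ, ℝ × F) ∞ M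
  fst_eq : ∀ x ∈ chart.source, (chart x).1 = π x

theorem exists_equiv_fst [FiniteDimensional ℝ F] (f : (ℝ × F) →L[ℝ] ℝ)
    (hf : Function.Surjective f) :
    ∃ A : (ℝ × F) ≃L[ℝ] (ℝ × F), ∀ u, (A u).1 = f u := by
  obtain ⟨v, hv⟩ := hf 1
  have hk : Module.finrank ℝ (LinearMap.ker f.toLinearMap) = Module.finrank ℝ F := by
    have h1 := LinearMap.finrank_range_add_finrank_ker f.toLinearMap
    have h2 : LinearMap.range f.toLinearMap = ⊤ := LinearMap.range_eq_top.2 hf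
    rw [h2] at h1
    simp at h1
    omega
  let κ : LinearMap.ker f.toLinearMap ≃ₗ[ℝ] F := LinearEquiv.ofFinrankEq _ _ hk
  let p : (ℝ × F) →ₗ[ℝ] LinearMap.ker f.toLinearMap :=
    LinearMap.codRestrict _ (LinearMap.id - (f.toLinearMap.smulRight v)) (by
      intro u; simp [hv])
  let A : (ℝ × F) →ₗ[ℝ] (ℝ × F) := f.toLinearMap.prod (κ.toLinearMap ∘ₗ p)
  have hA : Function.Injective A := by
    rw [← LinearMap.ker_eq_bot, LinearMap.ker_eq_bot']
    intro u hu
    have h1 : f u = 0 := congrArg Prod.fst hu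
    have h2 : p u = 0 := by
      have := congrArg Prod.snd hu
      exact κ.map_eq_zero_iff.1 this
    have h3 := congrArg Subtype.val h2
    simpa [p, h1, LinearMap.codRestrict] using h3
  refine ⟨(LinearEquiv.ofInjectiveEndo A hA).toContinuousLinearEquiv, fun u => rfl⟩

theorem exists_adaptedChart [FiniteDimensional ℝ F] [IsManifold 𝓘(ℝ, ℝ × F) ∞ M]
    (π : Fibration F M) (x : M) : ∃ a : AdaptedChart π, x ∈ a.chart.source := by
  let φ := chartAt (ℝ × F) x
  have hφ : φ ∈ IsManifold.maximalAtlas 𝓘(ℝ, ℝ × F) ∞ M := IsManifold.chart_mem_maximalAtlas x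
  have hxs : x ∈ φ.source := mem_chart_source _ x
  let f : ℝ × F → ℝ := fun u => π (φ.symm u)
  have hf : ContDiffOn ℝ ∞ f φ.target := by
    rw [← contMDiffOn_iff_contDiffOn]
    exact π.contMDiff.comp_contMDiffOn (contMDiffOn_symm_of_mem_maximalAtlas hφ)
  have hft : ContDiffAt ℝ ∞ f (φ x) :=
    (hf.contDiffAt (φ.open_target.mem_nhds (φ.map_source hxs)))
  have hdf : Function.Surjective (fderiv ℝ f (φ x)) := by
    have hφ1 := IsManifold.maximalAtlas_subset_of_le (m := 1) (by simp) hφ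
    have hm : φ.MDifferentiable 𝓘(ℝ, ℝ × F) 𝓘(ℝ, ℝ × F) :=
      ⟨fun y hy => (mdifferentiableAt_of_mem_maximalAtlas hφ1 hy).mdifferentiableWithinAt,
        fun y hy => (mdifferentiableAt_symm_of_mem_maximalAtlas hφ1 hy).mdifferentiableWithinAt⟩
    have e1 : mfderiv 𝓘(ℝ, ℝ × F) 𝓘(ℝ, ℝ) f (φ x)
        = (mfderiv 𝓘(ℝ, ℝ × F) 𝓘(ℝ, ℝ) π (φ.symm (φ x))).comp
          (mfderiv 𝓘(ℝ, ℝ × F) 𝓘(ℝ, ℝ × F) φ.symm (φ x)) :=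
      mfderiv_comp (φ x) ((π.contMDiff _).mdifferentiableAt (by simp))
        (hm.mdifferentiableAt_symm (φ.map_source hxs))
    rw [mfderiv_eq_fderiv] at e1
    rw [e1]
    exact (π.submersion _).comp (hm.symm.mfderiv_surjective (φ.map_source hxs))
  obtain ⟨A, hA⟩ := exists_equiv_fst _ hdf
  let g : ℝ × F → ℝ × F := fun u => (f u, (A u).2)
  have hgs : ContDiffOn ℝ ∞ g φ.target := hf.prodMk (A.contDiff.snd.contDiffOn)
  have hg : ContDiffAt ℝ ∞ g (φ x) :=
    hgs.contDiffAt (φ.open_target.mem_nhds (φ.map_source hxs))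
  have hg' : HasFDerivAt g (A : (ℝ × F) →L[ℝ] (ℝ × F)) (φ x) := by
    have h1 : HasFDerivAt f (fderiv ℝ f (φ x)) (φ x) :=
      (hft.differentiableAt (by simp)).hasFDerivAt
    have h2 : HasFDerivAt (fun u => (A u).2)
        ((ContinuousLinearMap.snd ℝ ℝ F).comp (A : (ℝ × F) →L[ℝ] (ℝ × F))) (φ x) :=
      ((ContinuousLinearMap.snd ℝ ℝ F).comp (A : (ℝ × F) →L[ℝ] (ℝ × F))).hasFDerivAt
    refine (h1.prodMk h2).congr_fderiv ?_
    ext u <;> simp [hA]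
  let G := hg.toOpenPartialHomeomorph g hg' (by simp)
  let R : Set ((ℝ × F) →L[ℝ] (ℝ × F)) :=
    Set.range ((↑) : ((ℝ × F) ≃L[ℝ] (ℝ × F)) → ((ℝ × F) →L[ℝ] (ℝ × F)))
  let U : Set (ℝ × F) := φ.target ∩ fderiv ℝ g ⁻¹' R
  have hU : IsOpen U := (hgs.continuousOn_fderiv_of_isOpen φ.open_target (by simp)).isOpen_inter_preimage
    φ.open_target ContinuousLinearEquiv.isOpen
  have hxU : φ x ∈ U := ⟨φ.map_source hxs, ⟨A, hg'.fderiv.symm⟩⟩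
  have hxG : φ x ∈ G.source := hg.mem_toOpenPartialHomeomorph_source hg' (by simp)
  let K := G.restrOpen U hU
  have hK : ContDiffOn ℝ ∞ K K.source := hgs.mono fun u hu => hu.2.1
  have hK' : ContDiffOn ℝ ∞ K.symm K.target := by
    intro y hy
    have hu := K.map_target hy
    obtain ⟨B, hB⟩ := hu.2.2
    have hd : ContDiffAt ℝ ∞ g (K.symm y) :=
      hgs.contDiffAt (φ.open_target.mem_nhds hu.2.1)
    refine (K.contDiffAt_symm hy (f₀' := B) ?_ hd).contDiffWithinAt
    rw [hB]
    exact (hd.differentiableAt (by simp)).hasFDerivAt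
  refine ⟨⟨φ ≫ₕ K, ?_, ?_⟩, ?_⟩
  · apply OpenPartialHomeomorph.mem_maximalAtlas_of_contMDiffOn
    · refine (hK.contMDiffOn).comp ((contMDiffOn_of_mem_maximalAtlas hφ).mono ?_) ?_
      · intro y hy; exact hy.1
      · intro y hy; exact hy.2
    · refine (contMDiffOn_symm_of_mem_maximalAtlas hφ).comp (hK'.contMDiffOn.mono ?_) ?_
      · intro y hy; exact hy.1
      · intro y hy; exact hy.2
  · intro y hy
    change π (φ.symm (φ y)) = π y
    rw [φ.left_inv hy.1]
  · exact ⟨hxs, hxG, hxU⟩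


namespace AdaptedChart

variable {π : Fibration F M} (a b : AdaptedChart π)

/-- The differential of an adapted chart at a point; `(a.D x).inverse` is its inverse when `x` is
in the domain of the chart. -/
def D (x : M) : TangentSpace 𝓘(ℝ, ℝ × F) x →L[ℝ] (ℝ × F) :=
  mfderiv 𝓘(ℝ, ℝ × F) 𝓘(ℝ, ℝ × F) a.chart x

/-- The change of coordinates from `a` to `b`. -/
def change : ℝ × F → ℝ × F := fun u => b.chart (a.chart.symm u)

theorem mdifferentiable : a.chart.MDifferentiable 𝓘(ℝ, ℝ × F) 𝓘(ℝ, ℝ × F) :=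
  have h := IsManifold.maximalAtlas_subset_of_le (m := 1) (by simp) a.mem_maximalAtlas
  ⟨fun _ hy => (mdifferentiableAt_of_mem_maximalAtlas h hy).mdifferentiableWithinAt,
    fun _ hy => (mdifferentiableAt_symm_of_mem_maximalAtlas h hy).mdifferentiableWithinAt⟩

/-- The differential of an adapted chart as a linear equivalence. -/
def DEquiv {x : M} (hx : x ∈ a.chart.source) : TangentSpace 𝓘(ℝ, ℝ × F) x ≃L[ℝ] (ℝ × F) :=
  a.mdifferentiable.mfderiv hx

theorem D_eq {x : M} (hx : x ∈ a.chart.source) :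
    a.D x = (a.DEquiv hx : TangentSpace 𝓘(ℝ, ℝ × F) x →L[ℝ] (ℝ × F)) := rfl

theorem D_inverse_D {x : M} (hx : x ∈ a.chart.source) (w : TangentSpace 𝓘(ℝ, ℝ × F) x) :
    (a.D x).inverse (a.D x w) = w := by
  rw [a.D_eq hx, ContinuousLinearMap.inverse_equiv]
  exact (a.DEquiv hx).symm_apply_apply w

theorem D_D_inverse {x : M} (hx : x ∈ a.chart.source) (w : ℝ × F) :
    a.D x ((a.D x).inverse w) = w := by
  rw [a.D_eq hx, ContinuousLinearMap.inverse_equiv]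
  exact (a.DEquiv hx).apply_symm_apply w

theorem fst_D {x : M} (hx : x ∈ a.chart.source) (w : TangentSpace 𝓘(ℝ, ℝ × F) x) :
    (a.D x w).1 = π.eta x w := by
  have h1 : (fun y => (a.chart y).1) =ᶠ[𝓝 x] π :=
    Filter.eventually_of_mem (a.chart.open_source.mem_nhds hx) a.fst_eq
  have h2 : mfderiv 𝓘(ℝ, ℝ × F) 𝓘(ℝ, ℝ) (fun y => (a.chart y).1) x
      = (mfderiv 𝓘(ℝ, ℝ × F) 𝓘(ℝ, ℝ) (Prod.fst : ℝ × F → ℝ) (a.chart x)).comp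
        (mfderiv 𝓘(ℝ, ℝ × F) 𝓘(ℝ, ℝ × F) a.chart x) :=
    mfderiv_comp x (mdifferentiableAt_iff_differentiableAt.2 differentiableAt_fst)
      (a.mdifferentiable.mdifferentiableAt hx)
  rw [h1.mfderiv_eq, mfderiv_eq_fderiv, fderiv_fst] at h2
  change _ = (mfderiv 𝓘(ℝ, ℝ × F) 𝓘(ℝ, ℝ) π x) w
  rw [h2]; rfl

theorem fst_chart_symm {u : ℝ × F} (hu : u ∈ a.chart.target) : π (a.chart.symm u) = u.1 := by
  rw [← a.fst_eq _ (a.chart.map_target hu), a.chart.right_inv hu]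

theorem isOpen_change_source : IsOpen (a.chart.symm.trans b.chart).source :=
  (a.chart.symm.trans b.chart).open_source

theorem contDiffOn_change : ContDiffOn ℝ ∞ (a.change b) (a.chart.symm.trans b.chart).source := by
  rw [← contMDiffOn_iff_contDiffOn]
  refine (contMDiffOn_of_mem_maximalAtlas b.mem_maximalAtlas).comp
    ((contMDiffOn_symm_of_mem_maximalAtlas a.mem_maximalAtlas).mono fun y hy => hy.1)
    fun y hy => hy.2

theorem D_comp_D_inverse {u : ℝ × F} (hu : u ∈ (a.chart.symm.trans b.chart).source) (w : ℝ × F) :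
    b.D (a.chart.symm u) ((a.D (a.chart.symm u)).inverse w) = fderiv ℝ (a.change b) u w := by
  have hs := a.chart.map_target hu.1
  have h2 : mfderiv 𝓘(ℝ, ℝ × F) 𝓘(ℝ, ℝ × F) (a.change b) u
      = (mfderiv 𝓘(ℝ, ℝ × F) 𝓘(ℝ, ℝ × F) b.chart (a.chart.symm u)).comp
        (mfderiv 𝓘(ℝ, ℝ × F) 𝓘(ℝ, ℝ × F) a.chart.symm u) :=
    mfderiv_comp u (b.mdifferentiable.mdifferentiableAt hu.2)
      (a.mdifferentiable.mdifferentiableAt_symm hu.1)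
  rw [mfderiv_eq_fderiv] at h2
  rw [h2]
  have h3 : (a.D (a.chart.symm u)).inverse w
      = mfderiv 𝓘(ℝ, ℝ × F) 𝓘(ℝ, ℝ × F) a.chart.symm u w := by
    have h4 := congrArg (fun A => A w) (a.mdifferentiable.comp_symm_deriv hu.1)
    have h5 := a.D_inverse_D hs (mfderiv 𝓘(ℝ, ℝ × F) 𝓘(ℝ, ℝ × F) a.chart.symm u w)
    rw [← h5]
    congr 1
    exact h4.symm
  rw [h3]; rfl

theorem fst_change {u : ℝ × F} (hu : u ∈ (a.chart.symm.trans b.chart).source) :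
    (a.change b u).1 = u.1 := by
  rw [← a.fst_chart_symm hu.1]; exact b.fst_eq _ hu.2

theorem symm_change {u : ℝ × F} (hu : u ∈ (a.chart.symm.trans b.chart).source) :
    b.chart.symm (a.change b u) = a.chart.symm u := b.chart.left_inv hu.2

theorem change_mem {u : ℝ × F} (hu : u ∈ (a.chart.symm.trans b.chart).source) :
    a.change b u ∈ (b.chart.symm.trans a.chart).source := by
  refine ⟨b.chart.map_source hu.2, ?_⟩
  have := a.chart.map_target hu.1
  rwa [← a.symm_change b hu] at this

theorem mem_change_source {x : M} (ha : x ∈ a.chart.source) (hb : x ∈ b.chart.source) :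
    a.chart x ∈ (a.chart.symm.trans b.chart).source := by
  refine ⟨a.chart.map_source ha, ?_⟩
  change a.chart.symm (a.chart x) ∈ b.chart.source
  rwa [a.chart.left_inv ha]

theorem fst_D_inverse {x : M} (hx : x ∈ a.chart.source) (w : ℝ × F) :
    π.eta x ((a.D x).inverse w) = w.1 := by
  rw [← a.fst_D hx, a.D_D_inverse hx]

end AdaptedChart

/-- A smooth atlas on a set `N`: bijections `chart i` of subsets of `N` onto subsets of `H` whose
transition maps are smooth with open domains. It makes `N` a smooth manifold. -/
structure SmoothAtlas (H : Type*) [NormedAddCommGroup H] [NormedSpace ℝ H] (N ι : Type*) where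
  chart : ι → PartialEquiv N H
  idx : N → ι
  mem_source : ∀ x, x ∈ (chart (idx x)).source
  isOpen_source : ∀ i j, IsOpen ((chart i).symm.trans (chart j)).source
  contDiffOn : ∀ i j, ContDiffOn ℝ ∞ ((chart i).symm.trans (chart j))
    ((chart i).symm.trans (chart j)).source

namespace SmoothAtlas

variable {H : Type*} [NormedAddCommGroup H] [NormedSpace ℝ H] {N ι : Type*} (A : SmoothAtlas H N ι)

def core : ChartedSpaceCore H N where
  atlas := Set.range A.chart
  chartAt x := A.chart (A.idx x)
  mem_chart_source := A.mem_source
  chart_mem_atlas x := ⟨_, rfl⟩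
  open_source := by rintro _ _ ⟨i, rfl⟩ ⟨j, rfl⟩; exact A.isOpen_source i j
  continuousOn_toFun := by rintro _ _ ⟨i, rfl⟩ ⟨j, rfl⟩; exact (A.contDiffOn i j).continuousOn

@[reducible] def topology : TopologicalSpace N := A.core.toTopologicalSpace

@[reducible] def charted : @ChartedSpace H _ N A.topology := A.core.toChartedSpace

def homeo (i : ι) : @OpenPartialHomeomorph N H A.topology _ :=
  A.core.openPartialHomeomorph (A.chart i) ⟨i, rfl⟩

theorem isManifold : @IsManifold ℝ _ H _ _ H _ 𝓘(ℝ, H) ∞ N A.topology A.charted := by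
  let _ := A.topology
  let _ := A.charted
  apply isManifold_of_contDiffOn
  intro e e' he he'
  obtain ⟨_, ⟨_, rfl⟩, _, ⟨⟨i, rfl⟩, rfl⟩, rfl⟩ := he
  obtain ⟨_, ⟨_, rfl⟩, _, ⟨⟨j, rfl⟩, rfl⟩, rfl⟩ := he'
  simpa using! A.contDiffOn i j

theorem homeo_mem (i : ι) :
    A.homeo i ∈ @IsManifold.maximalAtlas ℝ _ H _ _ H _ 𝓘(ℝ, H) ∞ N A.topology A.charted := by
  let _ := A.topology
  let _ := A.charted
  have := A.isManifold
  apply IsManifold.subset_maximalAtlas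
  exact Set.mem_iUnion.2 ⟨A.chart i, Set.mem_iUnion.2 ⟨⟨i, rfl⟩, rfl⟩⟩

end SmoothAtlas


/-- A surjective function that is the first coordinate of some chart around each point is a
fibration. -/
def Fibration.ofCharts {N G : Type*} [NormedAddCommGroup G] [NormedSpace ℝ G]
    [TopologicalSpace N] [ChartedSpace (ℝ × G) N] (p : N → ℝ) (hp : Function.Surjective p)
    (h : ∀ y, ∃ c ∈ IsManifold.maximalAtlas 𝓘(ℝ, ℝ × G) ∞ N, y ∈ c.source ∧
      ∀ z ∈ c.source, (c z).1 = p z) : Fibration G N where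
  toFun := p
  surjective := hp
  contMDiff := by
    intro y
    obtain ⟨c, hc, hy, hcp⟩ := h y
    have h1 : (fun z => (c z).1) =ᶠ[𝓝 y] p :=
      Filter.eventually_of_mem (c.open_source.mem_nhds hy) hcp
    refine ContMDiffAt.congr_of_eventuallyEq ?_ h1.symm
    exact (contDiff_fst.contMDiff.contMDiffAt).comp y (contMDiffAt_of_mem_maximalAtlas hc hy)
  submersion := by
    intro y
    obtain ⟨c, hc, hy, hcp⟩ := h y
    have h1 : (fun z => (c z).1) =ᶠ[𝓝 y] p :=
      Filter.eventually_of_mem (c.open_source.mem_nhds hy) hcp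
    have hc1 := IsManifold.maximalAtlas_subset_of_le (m := 1) (by simp) hc
    have hm : c.MDifferentiable 𝓘(ℝ, ℝ × G) 𝓘(ℝ, ℝ × G) :=
      ⟨fun y hy => (mdifferentiableAt_of_mem_maximalAtlas hc1 hy).mdifferentiableWithinAt,
        fun y hy => (mdifferentiableAt_symm_of_mem_maximalAtlas hc1 hy).mdifferentiableWithinAt⟩
    have h2 : mfderiv 𝓘(ℝ, ℝ × G) 𝓘(ℝ, ℝ) (fun z => (c z).1) y
        = (mfderiv 𝓘(ℝ, ℝ × G) 𝓘(ℝ, ℝ) (Prod.fst : ℝ × G → ℝ) (c y)).comp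
          (mfderiv 𝓘(ℝ, ℝ × G) 𝓘(ℝ, ℝ × G) c y) :=
      mfderiv_comp y (mdifferentiableAt_iff_differentiableAt.2 differentiableAt_fst)
        (hm.mdifferentiableAt hy)
    rw [h1.mfderiv_eq, mfderiv_eq_fderiv, fderiv_fst] at h2
    rw [h2]
    exact Prod.fst_surjective.comp (hm.mfderiv_surjective hy)

/-- Some tangent vector at `x` with `η = 1`. -/
def Fibration.unitVector (π : Fibration F M) (x : M) : TangentSpace 𝓘(ℝ, ℝ × F) x :=
  (π.submersion x (1 : ℝ)).choose

theorem Fibration.eta_unitVector (π : Fibration F M) (x : M) : π.eta x (π.unitVector x) = 1 :=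
  (π.submersion x (1 : ℝ)).choose_spec

section

variable [FiniteDimensional ℝ F] [IsManifold 𝓘(ℝ, ℝ × F) ∞ M]

/-- Some adapted chart around `x`. -/
def Fibration.chartAround (π : Fibration F M) (x : M) : AdaptedChart π :=
  (exists_adaptedChart π x).choose

theorem Fibration.mem_chartAround (π : Fibration F M) (x : M) :
    x ∈ (π.chartAround x).chart.source := (exists_adaptedChart π x).choose_spec

end

/-- The space `J^1π` of one-jets of local sections of `π`, as `{v ∈ TM : η(v) = 1}`. -/
structure Jet (π : Fibration F M) where
  pt : M
  vel : TangentSpace 𝓘(ℝ, ℝ × F) pt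
  eta_vel : π.eta pt vel = 1

/-- The jet `w` if `η(w) = 1`; any other `w` is first corrected by a multiple of a fixed vector. -/
def Jet.normalize (π : Fibration F M) (x : M) (w : TangentSpace 𝓘(ℝ, ℝ × F) x) : Jet π where
  pt := x
  vel := w + (1 - π.eta x w) • π.unitVector x
  eta_vel := by simp [π.eta_unitVector]

theorem Jet.normalize_of_eq (π : Fibration F M) (x : M) (w : TangentSpace 𝓘(ℝ, ℝ × F) x)
    (hw : π.eta x w = 1) : Jet.normalize π x w = ⟨x, w, hw⟩ := by
  simp [Jet.normalize, hw]

theorem Jet.normalize_vel {π : Fibration F M} (v : Jet π) : Jet.normalize π v.pt v.vel = v :=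
  Jet.normalize_of_eq π v.pt v.vel v.eta_vel

namespace AdaptedChart

variable {π : Fibration F M} (a b : AdaptedChart π)

/-- The coordinates `(t, (q, q̇))` on `J^1π` induced by an adapted chart. -/
def jetPartialEquiv : PartialEquiv (Jet π) (ℝ × (F × F)) where
  toFun v := ((a.chart v.pt).1, ((a.chart v.pt).2, (a.D v.pt v.vel).2))
  invFun p := Jet.normalize π (a.chart.symm (p.1, p.2.1))
    ((a.D (a.chart.symm (p.1, p.2.1))).inverse (1, p.2.2))
  source := {v | v.pt ∈ a.chart.source}
  target := {p | (p.1, p.2.1) ∈ a.chart.target}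
  map_source' v hv := a.chart.map_source hv
  map_target' p hp := a.chart.map_target hp
  left_inv' v hv := by
    have hv' : v.pt ∈ a.chart.source := hv
    have h1 : ((1 : ℝ), (a.D v.pt v.vel).2) = a.D v.pt v.vel := by
      ext
      · rw [a.fst_D hv', v.eta_vel]
      · rfl
    change Jet.normalize π (a.chart.symm (a.chart v.pt)) ((a.D (a.chart.symm (a.chart v.pt))).inverse
      (1, (a.D v.pt v.vel).2)) = v
    rw [a.chart.left_inv hv', h1, a.D_inverse_D hv', Jet.normalize_vel]
  right_inv' p hp := by
    have hp' : (p.1, p.2.1) ∈ a.chart.target := hp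
    have hs := a.chart.map_target hp'
    rw [Jet.normalize_of_eq _ _ _ (a.fst_D_inverse hs _)]
    simp only [a.D_D_inverse hs, a.chart.right_inv hp']

theorem jetPartialEquiv_change {p : ℝ × (F × F)}
    (hp : p ∈ (a.jetPartialEquiv.symm.trans b.jetPartialEquiv).source) :
    b.jetPartialEquiv (a.jetPartialEquiv.symm p) =
      ((a.change b (p.1, p.2.1)).1, ((a.change b (p.1, p.2.1)).2,
        (fderiv ℝ (a.change b) (p.1, p.2.1) (1, p.2.2)).2)) := by
  have hs := a.chart.map_target hp.1
  have : a.jetPartialEquiv.symm p = ⟨a.chart.symm (p.1, p.2.1), _, a.fst_D_inverse hs (1, p.2.2)⟩ :=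
    Jet.normalize_of_eq _ _ _ (a.fst_D_inverse hs _)
  rw [this, ← a.D_comp_D_inverse b (u := (p.1, p.2.1)) ⟨hp.1, ?_⟩]
  · rfl
  · exact hp.2

theorem jetPartialEquiv_source : (a.jetPartialEquiv.symm.trans b.jetPartialEquiv).source =
    (fun p : ℝ × (F × F) => (p.1, p.2.1)) ⁻¹' (a.chart.symm.trans b.chart).source := rfl

end AdaptedChart

/-- The smooth atlas of `J^1π` formed by the coordinates `(t, (q, q̇))`. -/
def Jet.smoothAtlas [FiniteDimensional ℝ F] [IsManifold 𝓘(ℝ, ℝ × F) ∞ M] (π : Fibration F M) :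
    SmoothAtlas (ℝ × (F × F)) (Jet π) (AdaptedChart π) where
  chart a := a.jetPartialEquiv
  idx v := π.chartAround v.pt
  mem_source v := π.mem_chartAround v.pt
  isOpen_source a b := (a.isOpen_change_source b).preimage (by fun_prop)
  contDiffOn a b := by
    have h0 : ContDiff ℝ ∞ (fun p : ℝ × (F × F) => (p.1, p.2.1)) := by fun_prop
    have h1 := (a.contDiffOn_change b).comp h0.contDiffOn
      (s := (a.jetPartialEquiv.symm.trans b.jetPartialEquiv).source) (fun p hp => hp)
    have h2 := ((a.contDiffOn_change b).fderiv_of_isOpen (a.isOpen_change_source b)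
      (m := ∞) (by simp)).comp h0.contDiffOn
      (s := (a.jetPartialEquiv.symm.trans b.jetPartialEquiv).source) (fun p hp => hp)
    have h3 : ContDiff ℝ ∞ (fun p : ℝ × (F × F) => ((1 : ℝ), p.2.2)) := by fun_prop
    refine ContDiffOn.congr (h1.fst.prodMk (h1.snd.prodMk (h2.clm_apply h3.contDiffOn).snd))
      fun p hp => ?_
    exact a.jetPartialEquiv_change b hp

section

variable [FiniteDimensional ℝ F] [IsManifold 𝓘(ℝ, ℝ × F) ∞ M] (π : Fibration F M)

instance : TopologicalSpace (Jet π) := (Jet.smoothAtlas π).topology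

instance : ChartedSpace (ℝ × (F × F)) (Jet π) := (Jet.smoothAtlas π).charted

instance : IsManifold 𝓘(ℝ, ℝ × (F × F)) ∞ (Jet π) := (Jet.smoothAtlas π).isManifold

variable {π} in
/-- The chart `(t, (q, q̇))`. -/
def AdaptedChart.jetChart (a : AdaptedChart π) : OpenPartialHomeomorph (Jet π) (ℝ × (F × F)) :=
  (Jet.smoothAtlas π).homeo a

variable {π} in
theorem AdaptedChart.jetChart_mem (a : AdaptedChart π) :
    a.jetChart ∈ IsManifold.maximalAtlas 𝓘(ℝ, ℝ × (F × F)) ∞ (Jet π) :=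
  (Jet.smoothAtlas π).homeo_mem a

/-- The projection `π_1 : J^1π → ℝ`; its form `η` is the one-form `η_1 = π_1^*(dt)`. -/
def Fibration.jet : Fibration (F × F) (Jet π) :=
  Fibration.ofCharts (fun v => π v.pt)
    (fun t => by
      obtain ⟨x, hx⟩ := π.surjective t
      exact ⟨Jet.normalize π x 0, hx⟩)
    (fun v => ⟨(π.chartAround v.pt).jetChart, AdaptedChart.jetChart_mem _, π.mem_chartAround v.pt,
      fun z hz => (π.chartAround v.pt).fst_eq z.pt hz⟩)

end

/-- The fibre at `x` of the vertical bundle `Vπ`. -/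
def Fibration.Vert (π : Fibration F M) (x : M) : Submodule ℝ (TangentSpace 𝓘(ℝ, ℝ × F) x) :=
  LinearMap.ker (π.eta x).toLinearMap

/-- A projection onto the vertical space; it is the identity on vertical vectors. -/
def Fibration.vertProj (π : Fibration F M) (x : M) :
    TangentSpace 𝓘(ℝ, ℝ × F) x →L[ℝ] π.Vert x :=
  (ContinuousLinearMap.id ℝ _ - (π.eta x).smulRight (π.unitVector x)).codRestrict (π.Vert x) (by
    intro w
    simp [Fibration.Vert, π.eta_unitVector])

theorem Fibration.vertProj_coe (π : Fibration F M) (x : M) (w : TangentSpace 𝓘(ℝ, ℝ × F) x)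
    (hw : π.eta x w = 0) : π.vertProj x w = ⟨w, hw⟩ := by
  ext1
  change w - π.eta x w • π.unitVector x = w
  simp [hw]

/-- The total space of `V^*π`, the dual of the vertical bundle. -/
structure VDual (π : Fibration F M) where
  pt : M
  covec : π.Vert pt →L[ℝ] ℝ

namespace AdaptedChart

variable {π : Fibration F M} (a b : AdaptedChart π)

/-- The coordinates `(t, (q, p))` on `V^*π` induced by an adapted chart, where `p` is the covector
`u ↦ α(u^i ∂/∂q^i)`. -/
def dualPartialEquiv : PartialEquiv (VDual π) (ℝ × (F × (F →L[ℝ] ℝ))) where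
  toFun α := ((a.chart α.pt).1, ((a.chart α.pt).2,
    α.covec ∘L π.vertProj α.pt ∘L (a.D α.pt).inverse ∘L ContinuousLinearMap.inr ℝ ℝ F))
  invFun p := ⟨a.chart.symm (p.1, p.2.1),
    p.2.2 ∘L ContinuousLinearMap.snd ℝ ℝ F ∘L a.D (a.chart.symm (p.1, p.2.1)) ∘L
      (π.Vert (a.chart.symm (p.1, p.2.1))).subtypeL⟩
  source := {α | α.pt ∈ a.chart.source}
  target := {p | (p.1, p.2.1) ∈ a.chart.target}
  map_source' v hv := a.chart.map_source hv
  map_target' p hp := a.chart.map_target hp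
  left_inv' α hα := by
    have hα' : α.pt ∈ a.chart.source := hα
    obtain ⟨x, c⟩ := α
    have key : ∀ y, y = x → (⟨y, (c ∘L π.vertProj x ∘L (a.D x).inverse ∘L
        ContinuousLinearMap.inr ℝ ℝ F) ∘L ContinuousLinearMap.snd ℝ ℝ F ∘L a.D y ∘L
      (π.Vert y).subtypeL⟩ : VDual π) = ⟨x, c⟩ := by
      rintro y rfl
      congr 1
      ext X
      have h1 : ((0 : ℝ), (a.D y X).2) = a.D y X := by
        ext
        · rw [a.fst_D hα']; exact X.2.symm
        · rfl
      simp only [ContinuousLinearMap.comp_apply, ContinuousLinearMap.inr_apply,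
        ContinuousLinearMap.coe_snd', Submodule.subtypeL_apply]
      rw [h1, a.D_inverse_D hα', π.vertProj_coe y X X.2]
    exact key _ (a.chart.left_inv hα')
  right_inv' p hp := by
    have hp' : (p.1, p.2.1) ∈ a.chart.target := hp
    have hs := a.chart.map_target hp'
    ext1
    · simp [a.chart.right_inv hp']
    ext1
    · simp [a.chart.right_inv hp']
    ext u
    simp only [ContinuousLinearMap.comp_apply, ContinuousLinearMap.inr_apply,
        ContinuousLinearMap.coe_snd', Submodule.subtypeL_apply]
    rw [π.vertProj_coe _ _ (a.fst_D_inverse hs (0, u))]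
    simp only [a.D_D_inverse hs]

theorem dualPartialEquiv_change {p : ℝ × (F × (F →L[ℝ] ℝ))}
    (hp : p ∈ (a.dualPartialEquiv.symm.trans b.dualPartialEquiv).source) :
    b.dualPartialEquiv (a.dualPartialEquiv.symm p) =
      ((a.change b (p.1, p.2.1)).1, ((a.change b (p.1, p.2.1)).2,
        p.2.2 ∘L ContinuousLinearMap.snd ℝ ℝ F ∘L
          fderiv ℝ (b.change a) (a.change b (p.1, p.2.1)) ∘L ContinuousLinearMap.inr ℝ ℝ F)) := by
  have hs := a.chart.map_target hp.1
  have hs2 : a.chart.symm (p.1, p.2.1) ∈ b.chart.source := hp.2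
  ext1
  · rfl
  ext1
  · rfl
  ext u
  have h1 := a.change_mem b (u := (p.1, p.2.1)) hp
  have h2 := b.D_comp_D_inverse a h1 (0, u)
  have h3 : b.chart.symm (a.change b (p.1, p.2.1)) = a.chart.symm (p.1, p.2.1) :=
    b.chart.left_inv hs2
  rw [h3] at h2
  simp only [ContinuousLinearMap.comp_apply, ContinuousLinearMap.inr_apply,
        ContinuousLinearMap.coe_snd']
  rw [← h2]
  change p.2.2 (a.D _ (π.vertProj _ ((b.D (a.chart.symm (p.1, p.2.1))).inverse (0, u))).1).2 = _
  rw [π.vertProj_coe _ _ (b.fst_D_inverse hs2 (0, u))]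

end AdaptedChart

/-- The smooth atlas of `V^*π` formed by the coordinates `(t, (q, p))`. -/
def VDual.smoothAtlas [FiniteDimensional ℝ F] [IsManifold 𝓘(ℝ, ℝ × F) ∞ M] (π : Fibration F M) :
    SmoothAtlas (ℝ × (F × (F →L[ℝ] ℝ))) (VDual π) (AdaptedChart π) where
  chart a := a.dualPartialEquiv
  idx v := π.chartAround v.pt
  mem_source v := π.mem_chartAround v.pt
  isOpen_source a b := (a.isOpen_change_source b).preimage
    (f := fun p : ℝ × (F × (F →L[ℝ] ℝ)) => (p.1, p.2.1)) (by fun_prop)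
  contDiffOn a b := by
    have h0 : ContDiff ℝ ∞ (fun p : ℝ × (F × (F →L[ℝ] ℝ)) => (p.1, p.2.1)) := by fun_prop
    have h1 := (a.contDiffOn_change b).comp h0.contDiffOn
      (s := (a.dualPartialEquiv.symm.trans b.dualPartialEquiv).source) (fun p hp => hp)
    have h2 := ((b.contDiffOn_change a).fderiv_of_isOpen (b.isOpen_change_source a)
      (m := ∞) (by simp)).comp h1
      (s := (a.dualPartialEquiv.symm.trans b.dualPartialEquiv).source) (fun p hp => a.change_mem b hp)
    have h3 : ContDiff ℝ ∞ (fun p : ℝ × (F × (F →L[ℝ] ℝ)) =>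
      p.2.2 ∘L ContinuousLinearMap.snd ℝ ℝ F) :=
      contDiff_snd.snd.clm_comp contDiff_const
    refine ContDiffOn.congr (h1.fst.prodMk (h1.snd.prodMk (h3.contDiffOn.clm_comp
      (h2.clm_comp (contDiffOn_const (c := ContinuousLinearMap.inr ℝ ℝ F))))))
      fun p hp => ?_
    exact a.dualPartialEquiv_change b hp

section

variable [FiniteDimensional ℝ F] [IsManifold 𝓘(ℝ, ℝ × F) ∞ M] (π : Fibration F M)

instance : TopologicalSpace (VDual π) := (VDual.smoothAtlas π).topology

instance : ChartedSpace (ℝ × (F × (F →L[ℝ] ℝ))) (VDual π) := (VDual.smoothAtlas π).charted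

instance : IsManifold 𝓘(ℝ, ℝ × (F × (F →L[ℝ] ℝ))) ∞ (VDual π) := (VDual.smoothAtlas π).isManifold

/-- The projection `π_1^* : V^*π → ℝ`. Hence `Jet π.dual` is `J^1π_1^*`. -/
def Fibration.dual : Fibration (F × (F →L[ℝ] ℝ)) (VDual π) :=
  Fibration.ofCharts (fun v => π v.pt)
    (fun t => by
      obtain ⟨x, hx⟩ := π.surjective t
      exact ⟨⟨x, 0⟩, hx⟩)
    (fun v => ⟨(VDual.smoothAtlas π).homeo (π.chartAround v.pt), (VDual.smoothAtlas π).homeo_mem _,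
      π.mem_chartAround v.pt,
      fun z hz => (π.chartAround v.pt).fst_eq z.pt hz⟩)

variable {π} in
/-- The coordinates `(t, (q, p))` as a chart adapted to `π_1^*`. -/
def AdaptedChart.dual (a : AdaptedChart π) : AdaptedChart π.dual where
  chart := (VDual.smoothAtlas π).homeo a
  mem_maximalAtlas := (VDual.smoothAtlas π).homeo_mem a
  fst_eq z hz := a.fst_eq z.pt hz

variable {π} in
/-- The coordinates `(t, (q, q̇))` as a chart adapted to `π_1`. Hence `a.dual.jet` is the chart
`(t, ((q, p), (q̇, ṗ)))` of `J^1π_1^*`. -/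
def AdaptedChart.jet (a : AdaptedChart π) : AdaptedChart π.jet where
  chart := (Jet.smoothAtlas π).homeo a
  mem_maximalAtlas := (Jet.smoothAtlas π).homeo_mem a
  fst_eq z hz := a.fst_eq z.pt hz

/-- The quotient bundle `T^*(J^1π)/⟨η_1⟩`. -/
abbrev RedCotangent : Type _ :=
  Σ v : Jet π, (TangentSpace 𝓘(ℝ, ℝ × (F × F)) v →L[ℝ] ℝ) ⧸
    Submodule.span ℝ {π.jet.eta v}

variable {π}

/-- The components `(p_q, p_q̇)` of a class of covectors, as the covector
`(u, w) ↦ p_q(u) + p_q̇(w)`. -/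
def AdaptedChart.momenta (a : AdaptedChart π) {v : Jet π} (hv : v.pt ∈ a.chart.source) :
    ((TangentSpace 𝓘(ℝ, ℝ × (F × F)) v →L[ℝ] ℝ) ⧸ Submodule.span ℝ {π.jet.eta v}) →ₗ[ℝ]
      (F × F →L[ℝ] ℝ) :=
  Submodule.liftQ _
    { toFun := fun α => α ∘L (a.jet.D v).inverse ∘L ContinuousLinearMap.inr ℝ ℝ (F × F)
      map_add' := fun _ _ => rfl
      map_smul' := fun _ _ => rfl }
    (by
      rw [Submodule.span_le, Set.singleton_subset_iff]
      exact ContinuousLinearMap.ext fun u => a.jet.fst_D_inverse (x := v) hv (0, u))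

/-- The tuple `(t, ((q, p_q̇), (q̇, p_q)))` of a class of covectors at `v`. -/
def AdaptedChart.redCoord (a : AdaptedChart π) (v : Jet π) (hv : v.pt ∈ a.chart.source)
    (ξ : (TangentSpace 𝓘(ℝ, ℝ × (F × F)) v →L[ℝ] ℝ) ⧸ Submodule.span ℝ {π.jet.eta v}) :
    ℝ × ((F × (F →L[ℝ] ℝ)) × (F × (F →L[ℝ] ℝ))) :=
  ((a.jet.chart v).1,
    (((a.jet.chart v).2.1, a.momenta hv ξ ∘L ContinuousLinearMap.inr ℝ F F),
      ((a.jet.chart v).2.2, a.momenta hv ξ ∘L ContinuousLinearMap.inl ℝ F F)))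

/-- The map `T^*(J^1π)/⟨η_1⟩ → J^1π_1^*` with local expression
`(t, q, q̇; p_q, p_q̇) ↦ (t, q, p_q̇; q̇, p_q)`. It is written with one adapted chart around the base
point; `AdaptedChart.chart_tulczyjewInv` shows that every adapted chart gives the same map. -/
def tulczyjewInv (ζ : RedCotangent π) : Jet π.dual :=
  (π.chartAround ζ.1.pt).dual.jet.chart.symm
    ((π.chartAround ζ.1.pt).redCoord ζ.1 (π.mem_chartAround ζ.1.pt) ζ.2)

theorem tulczyjewInv_pt (ζ : RedCotangent π) : (tulczyjewInv ζ).pt.pt = ζ.1.pt :=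
  (π.chartAround ζ.1.pt).chart.left_inv (π.mem_chartAround ζ.1.pt)

theorem AdaptedChart.snd_fderiv_jet_change (a b : AdaptedChart π) {v : Jet π}
    (ha : v.pt ∈ a.chart.source) (hb : v.pt ∈ b.chart.source) (u : F × F) :
    (b.jet.D v ((a.jet.D v).inverse (0, u))) =
      (0, ((fderiv ℝ (a.change b) (a.chart v.pt) (0, u.1)).2,
        (fderiv ℝ (fderiv ℝ (a.change b)) (a.chart v.pt) (0, u.1) (a.D v.pt v.vel)).2 +
        (fderiv ℝ (a.change b) (a.chart v.pt) (0, u.2)).2)) := by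
  have ha' : v ∈ a.jet.chart.source := ha
  have hb' : v ∈ b.jet.chart.source := hb
  have hw := a.jet.mem_change_source b.jet ha' hb'
  have h1 := a.jet.D_comp_D_inverse b.jet hw (0, u)
  rw [a.jet.chart.left_inv ha'] at h1
  have h0 : (b.jet.D v ((a.jet.D v).inverse (0, u))).1 = 0 := by
    rw [b.jet.fst_D (x := v) hb, a.jet.fst_D_inverse (x := v) ha]
  have hx := a.mem_change_source b ha hb
  have hc : ContDiffAt ℝ ∞ (a.change b) (a.chart v.pt) :=
    (a.contDiffOn_change b).contDiffAt ((a.isOpen_change_source b).mem_nhds hx)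
  have hg : HasFDerivAt (a.change b) (fderiv ℝ (a.change b) (a.chart v.pt)) (a.chart v.pt) :=
    (hc.differentiableAt (by simp)).hasFDerivAt
  have hg2 : HasFDerivAt (fderiv ℝ (a.change b))
      (fderiv ℝ (fderiv ℝ (a.change b)) (a.chart v.pt)) (a.chart v.pt) :=
    ((hc.fderiv_right (m := ∞) (by simp)).differentiableAt (by simp)).hasFDerivAt
  have hev : a.jet.change b.jet =ᶠ[𝓝 (a.jet.chart v)] fun p =>
      ((a.change b (p.1, p.2.1)).1, ((a.change b (p.1, p.2.1)).2,
        (fderiv ℝ (a.change b) (p.1, p.2.1) (1, p.2.2)).2)) :=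
    Filter.eventually_of_mem ((a.jet.isOpen_change_source b.jet).mem_nhds hw)
      fun p hp => a.jetPartialEquiv_change b hp
  let l : ℝ × (F × F) →L[ℝ] ℝ × F := (ContinuousLinearMap.fst ℝ ℝ (F × F)).prod
    (ContinuousLinearMap.fst ℝ F F ∘L ContinuousLinearMap.snd ℝ ℝ (F × F))
  have hl : HasFDerivAt (fun p : ℝ × (F × F) => (p.1, p.2.1)) l (a.jet.chart v) := l.hasFDerivAt
  have hr : HasFDerivAt (fun p : ℝ × (F × F) => ((1 : ℝ), p.2.2))
      ((0 : ℝ × (F × F) →L[ℝ] ℝ).prod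
        (ContinuousLinearMap.snd ℝ F F ∘L ContinuousLinearMap.snd ℝ ℝ (F × F))) (a.jet.chart v) :=
    (hasFDerivAt_const _ _).prodMk
      (ContinuousLinearMap.snd ℝ F F ∘L ContinuousLinearMap.snd ℝ ℝ (F × F)).hasFDerivAt
  have hgl := hg.comp (f := fun p : ℝ × (F × F) => (p.1, p.2.1)) (a.jet.chart v) hl
  have hg2l := hg2.comp (f := fun p : ℝ × (F × F) => (p.1, p.2.1)) (a.jet.chart v) hl
  have hd := hgl.fst.prodMk (hgl.snd.prodMk (hg2l.clm_apply hr).snd)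
  have h2 := (hd.congr_of_eventuallyEq hev).fderiv
  have hvel : ((1 : ℝ), (a.D v.pt v.vel).2) = a.D v.pt v.vel := by
    ext
    · rw [a.fst_D ha, v.eta_vel]
    · rfl
  rw [h2] at h1
  refine Prod.ext h0 ?_
  rw [h1]
  refine Prod.ext rfl ?_
  change (fderiv ℝ (a.change b) (a.chart v.pt) (0, u.2) +
    fderiv ℝ (fderiv ℝ (a.change b)) (a.chart v.pt) (0, u.1) (1, (a.D v.pt v.vel).2)).2 = _
  rw [hvel]
  exact add_comm _ _

theorem AdaptedChart.dual_change_deriv (a b : AdaptedChart π) {u : ℝ × F}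
    (hu : u ∈ (a.chart.symm.trans b.chart).source) (p : F →L[ℝ] ℝ) (du : ℝ × F) (dp : F →L[ℝ] ℝ) :
    (fderiv ℝ (a.dual.change b.dual) (u.1, (u.2, p)) (du.1, (du.2, dp))).2 =
      ((fderiv ℝ (a.change b) u du).2,
        dp ∘L ContinuousLinearMap.snd ℝ ℝ F ∘L
          fderiv ℝ (b.change a) (a.change b u) ∘L ContinuousLinearMap.inr ℝ ℝ F +
        p ∘L ContinuousLinearMap.snd ℝ ℝ F ∘L
          (fderiv ℝ (fderiv ℝ (b.change a)) (a.change b u) (fderiv ℝ (a.change b) u du)) ∘L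
            ContinuousLinearMap.inr ℝ ℝ F) := by
  have hv := a.change_mem b hu
  have hca : ContDiffAt ℝ ∞ (a.change b) u :=
    (a.contDiffOn_change b).contDiffAt ((a.isOpen_change_source b).mem_nhds hu)
  have hf : HasFDerivAt (a.change b) (fderiv ℝ (a.change b) u) u :=
    (hca.differentiableAt (by simp)).hasFDerivAt
  have hc : ContDiffAt ℝ ∞ (b.change a) (a.change b u) :=
    (b.contDiffOn_change a).contDiffAt ((b.isOpen_change_source a).mem_nhds hv)
  have hg2 : HasFDerivAt (fderiv ℝ (b.change a))
      (fderiv ℝ (fderiv ℝ (b.change a)) (a.change b u)) (a.change b u) :=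
    ((hc.fderiv_right (m := ∞) (by simp)).differentiableAt (by simp)).hasFDerivAt
  let P : ℝ × (F × (F →L[ℝ] ℝ)) := (u.1, (u.2, p))
  have hP : P ∈ (a.dual.chart.symm.trans b.dual.chart).source := hu
  have hev : a.dual.change b.dual =ᶠ[𝓝 P] fun p =>
      ((a.change b (p.1, p.2.1)).1, ((a.change b (p.1, p.2.1)).2,
        p.2.2 ∘L ContinuousLinearMap.snd ℝ ℝ F ∘L
          fderiv ℝ (b.change a) (a.change b (p.1, p.2.1)) ∘L ContinuousLinearMap.inr ℝ ℝ F)) :=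
    Filter.eventually_of_mem ((a.dual.isOpen_change_source b.dual).mem_nhds hP)
      fun p hp => a.dualPartialEquiv_change b hp
  let E := ℝ × (F × (F →L[ℝ] ℝ))
  let l : E →L[ℝ] ℝ × F := (ContinuousLinearMap.fst ℝ ℝ _).prod
    (ContinuousLinearMap.fst ℝ F _ ∘L ContinuousLinearMap.snd ℝ ℝ _)
  have hl : HasFDerivAt (fun p : E => (p.1, p.2.1)) l P := l.hasFDerivAt
  let r : E →L[ℝ] (F →L[ℝ] ℝ) := ContinuousLinearMap.snd ℝ F _ ∘L ContinuousLinearMap.snd ℝ ℝ _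
  have hr : HasFDerivAt (fun p : E => p.2.2) r P := r.hasFDerivAt
  have hfl := hf.comp (f := fun p : E => (p.1, p.2.1)) P hl
  have hg2l := hg2.comp (f := fun p : E => a.change b (p.1, p.2.1)) P hfl
  have hd := hfl.fst.prodMk (hfl.snd.prodMk (hr.clm_comp
    ((hasFDerivAt_const (ContinuousLinearMap.snd ℝ ℝ F) P).clm_comp
      (hg2l.clm_comp (hasFDerivAt_const (ContinuousLinearMap.inr ℝ ℝ F) P)))))
  have h2 := (hd.congr_of_eventuallyEq hev).fderiv
  change (fderiv ℝ (a.dual.change b.dual) P (du.1, (du.2, dp))).2 = _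
  rw [h2]
  refine Prod.ext rfl ?_
  refine ContinuousLinearMap.ext fun y => ?_
  simp [P, l, r]
  exact add_comm _ _

theorem AdaptedChart.D_change (a b : AdaptedChart π) {x : M} (ha : x ∈ a.chart.source)
    (hb : x ∈ b.chart.source) (w : TangentSpace 𝓘(ℝ, ℝ × F) x) :
    fderiv ℝ (a.change b) (a.chart x) (a.D x w) = b.D x w := by
  have h := a.D_comp_D_inverse b (a.mem_change_source b ha hb) (a.D x w)
  rw [a.chart.left_inv ha, a.D_inverse_D ha] at h
  exact h.symm

theorem AdaptedChart.momenta_change (a b : AdaptedChart π) {v : Jet π}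
    (ha : v.pt ∈ a.chart.source) (hb : v.pt ∈ b.chart.source)
    (ξ : (TangentSpace 𝓘(ℝ, ℝ × (F × F)) v →L[ℝ] ℝ) ⧸ Submodule.span ℝ {π.jet.eta v})
    (u : F × F) :
    a.momenta ha ξ u = b.momenta hb ξ ((fderiv ℝ (a.change b) (a.chart v.pt) (0, u.1)).2,
        (fderiv ℝ (fderiv ℝ (a.change b)) (a.chart v.pt) (0, u.1) (a.D v.pt v.vel)).2 +
        (fderiv ℝ (a.change b) (a.chart v.pt) (0, u.2)).2) := by
  obtain ⟨α, rfl⟩ := Submodule.Quotient.mk_surjective _ ξ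
  change α ((a.jet.D v).inverse (0, u)) = α ((b.jet.D v).inverse (0, _))
  have h := b.jet.D_inverse_D (x := v) hb ((a.jet.D v).inverse (0, u))
  rw [a.snd_fderiv_jet_change b ha hb u] at h
  exact congrArg α h.symm


theorem AdaptedChart.mem_jet_change_source (a b : AdaptedChart π) {p : ℝ × (F × F)}
    (hp : (p.1, p.2.1) ∈ (a.chart.symm.trans b.chart).source) :
    p ∈ (a.jet.chart.symm.trans b.jet.chart).source := hp

theorem AdaptedChart.jet_change_apply (a b : AdaptedChart π) {p : ℝ × (F × F)}
    (hp : (p.1, p.2.1) ∈ (a.chart.symm.trans b.chart).source) :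
    a.jet.change b.jet p =
      ((a.change b (p.1, p.2.1)).1, ((a.change b (p.1, p.2.1)).2,
        (fderiv ℝ (a.change b) (p.1, p.2.1) (1, p.2.2)).2)) :=
  a.jetPartialEquiv_change b hp

theorem AdaptedChart.mem_dual_change_source (a b : AdaptedChart π)
    {p : ℝ × (F × (F →L[ℝ] ℝ))}
    (hp : (p.1, p.2.1) ∈ (a.chart.symm.trans b.chart).source) :
    p ∈ (a.dual.chart.symm.trans b.dual.chart).source := hp

theorem AdaptedChart.dual_change_apply (a b : AdaptedChart π) {p : ℝ × (F × (F →L[ℝ] ℝ))}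
    (hp : (p.1, p.2.1) ∈ (a.chart.symm.trans b.chart).source) :
    a.dual.change b.dual p =
      ((a.change b (p.1, p.2.1)).1, ((a.change b (p.1, p.2.1)).2,
        p.2.2 ∘L ContinuousLinearMap.snd ℝ ℝ F ∘L
          fderiv ℝ (b.change a) (a.change b (p.1, p.2.1)) ∘L ContinuousLinearMap.inr ℝ ℝ F)) :=
  a.dualPartialEquiv_change b hp

theorem AdaptedChart.dual_jet_change_apply (a b : AdaptedChart π) {u : ℝ × F}
    (hu : u ∈ (a.chart.symm.trans b.chart).source) (p : F →L[ℝ] ℝ) (du : F) (dp : F →L[ℝ] ℝ) :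
    a.dual.jet.change b.dual.jet (u.1, ((u.2, p), (du, dp))) =
      ((a.change b u).1, (((a.change b u).2, p ∘L ContinuousLinearMap.snd ℝ ℝ F ∘L
          fderiv ℝ (b.change a) (a.change b u) ∘L ContinuousLinearMap.inr ℝ ℝ F),
        ((fderiv ℝ (a.change b) u (1, du)).2,
        dp ∘L ContinuousLinearMap.snd ℝ ℝ F ∘L
          fderiv ℝ (b.change a) (a.change b u) ∘L ContinuousLinearMap.inr ℝ ℝ F +
        p ∘L ContinuousLinearMap.snd ℝ ℝ F ∘L
          (fderiv ℝ (fderiv ℝ (b.change a)) (a.change b u) (fderiv ℝ (a.change b) u (1, du))) ∘L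
            ContinuousLinearMap.inr ℝ ℝ F))) := by
  have h1 := a.dual.jet_change_apply b.dual (p := (u.1, ((u.2, p), (du, dp))))
    (a.mem_dual_change_source b hu)
  have h3 := a.dual_change_deriv b hu p (1, du) dp
  have h2 := a.dual_change_apply b (p := (u.1, (u.2, p))) hu
  rw [h1]
  dsimp only at h2 h3 ⊢
  rw [h3, h2]

theorem AdaptedChart.momenta_inr (a b : AdaptedChart π) {v : Jet π}
    (ha : v.pt ∈ a.chart.source) (hb : v.pt ∈ b.chart.source)
    (ξ : (TangentSpace 𝓘(ℝ, ℝ × (F × F)) v →L[ℝ] ℝ) ⧸ Submodule.span ℝ {π.jet.eta v}) :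
    (b.momenta hb ξ ∘L ContinuousLinearMap.inr ℝ F F) ∘L ContinuousLinearMap.snd ℝ ℝ F ∘L
      fderiv ℝ (a.change b) (a.chart v.pt) ∘L ContinuousLinearMap.inr ℝ ℝ F =
    a.momenta ha ξ ∘L ContinuousLinearMap.inr ℝ F F := by
  refine ContinuousLinearMap.ext fun y => ?_
  have z1 : fderiv ℝ (fderiv ℝ (a.change b)) (a.chart v.pt) (0, 0) = 0 := map_zero _
  have z2 : fderiv ℝ (a.change b) (a.chart v.pt) (0, 0) = 0 := map_zero _
  have h := a.momenta_change b ha hb ξ (0, y)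
  rw [z1, z2] at h
  refine Eq.trans ?_ h.symm
  refine congrArg (b.momenta hb ξ) (Prod.ext rfl ?_)
  exact (zero_add _).symm

theorem AdaptedChart.momenta_inl (a b : AdaptedChart π) {v : Jet π}
    (ha : v.pt ∈ a.chart.source) (hb : v.pt ∈ b.chart.source)
    (ξ : (TangentSpace 𝓘(ℝ, ℝ × (F × F)) v →L[ℝ] ℝ) ⧸ Submodule.span ℝ {π.jet.eta v}) :
    (b.momenta hb ξ ∘L ContinuousLinearMap.inl ℝ F F) ∘L ContinuousLinearMap.snd ℝ ℝ F ∘L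
      fderiv ℝ (a.change b) (a.chart v.pt) ∘L ContinuousLinearMap.inr ℝ ℝ F +
    (b.momenta hb ξ ∘L ContinuousLinearMap.inr ℝ F F) ∘L ContinuousLinearMap.snd ℝ ℝ F ∘L
      fderiv ℝ (fderiv ℝ (a.change b)) (a.chart v.pt) (a.D v.pt v.vel) ∘L
        ContinuousLinearMap.inr ℝ ℝ F =
    a.momenta ha ξ ∘L ContinuousLinearMap.inl ℝ F F := by
  refine ContinuousLinearMap.ext fun y => ?_
  have hc : ContDiffAt ℝ ∞ (a.change b) (a.chart v.pt) :=
    (a.contDiffOn_change b).contDiffAt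
      ((a.isOpen_change_source b).mem_nhds (a.mem_change_source b ha hb))
  have hs : IsSymmSndFDerivAt ℝ (a.change b) (a.chart v.pt) :=
    hc.isSymmSndFDerivAt (by simpa using! (WithTop.coe_le_coe.2 (le_top (a := (2 : ℕ∞)))))
  have z2 : fderiv ℝ (a.change b) (a.chart v.pt) (0, 0) = 0 := map_zero _
  have h := a.momenta_change b ha hb ξ (y, 0)
  rw [z2, hs.eq] at h
  refine Eq.trans ?_ h.symm
  refine ((b.momenta hb ξ).map_add (_, 0) (0, _)).symm.trans ?_
  refine congrArg (b.momenta hb ξ) (Prod.ext (add_zero _) ?_)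
  exact (zero_add _).trans (add_zero _).symm

theorem AdaptedChart.redCoord_change (a b : AdaptedChart π) (v : Jet π)
    (ha : v.pt ∈ a.chart.source) (hb : v.pt ∈ b.chart.source)
    (ξ : (TangentSpace 𝓘(ℝ, ℝ × (F × F)) v →L[ℝ] ℝ) ⧸ Submodule.span ℝ {π.jet.eta v}) :
    b.dual.jet.change a.dual.jet (b.redCoord v hb ξ) = a.redCoord v ha ξ := by
  have hu := b.mem_change_source a hb ha
  have hua : b.change a (b.chart v.pt) = a.chart v.pt := by
    change a.chart (b.chart.symm (b.chart v.pt)) = _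
    rw [b.chart.left_inv hb]
  have hvel : ((1 : ℝ), (b.D v.pt v.vel).2) = b.D v.pt v.vel := by
    ext
    · rw [b.fst_D hb, v.eta_vel]
    · rfl
  refine (b.dual_jet_change_apply a hu (b.momenta hb ξ ∘L ContinuousLinearMap.inr ℝ F F)
    (b.D v.pt v.vel).2 (b.momenta hb ξ ∘L ContinuousLinearMap.inl ℝ F F)).trans ?_
  rw [hvel, b.D_change a hb ha, hua, a.momenta_inr b ha hb, a.momenta_inl b ha hb]
  rfl

theorem AdaptedChart.chart_tulczyjewInv (a : AdaptedChart π) (v : Jet π)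
    (ha : v.pt ∈ a.chart.source)
    (ξ : (TangentSpace 𝓘(ℝ, ℝ × (F × F)) v →L[ℝ] ℝ) ⧸ Submodule.span ℝ {π.jet.eta v}) :
    a.dual.jet.chart (tulczyjewInv ⟨v, ξ⟩) = a.redCoord v ha ξ :=
  a.redCoord_change (π.chartAround v.pt) v ha (π.mem_chartAround v.pt) ξ


theorem tulczyjewInv_injective : Function.Injective (tulczyjewInv (π := π)) := by
  rintro ⟨v, ξ⟩ ⟨v', ξ'⟩ h
  have hpt : v'.pt = v.pt := by
    rw [← tulczyjewInv_pt ⟨v, ξ⟩, ← tulczyjewInv_pt ⟨v', ξ'⟩, h]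
  let a := π.chartAround v.pt
  have hm : v.pt ∈ a.chart.source := π.mem_chartAround v.pt
  have hm' : v'.pt ∈ a.chart.source := hpt ▸ hm
  have he := a.chart_tulczyjewInv v hm ξ
  rw [h, a.chart_tulczyjewInv v' hm' ξ'] at he
  simp only [AdaptedChart.redCoord, Prod.mk.injEq] at he
  obtain ⟨e1, ⟨e2, e3⟩, e4, e5⟩ := he
  have hv : v' = v := by
    apply a.jet.chart.injOn (show v' ∈ a.jet.chart.source from hm')
      (show v ∈ a.jet.chart.source from hm)
    exact Prod.ext e1 (Prod.ext e2 e4)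
  subst hv
  congr 1
  obtain ⟨α, rfl⟩ := Submodule.Quotient.mk_surjective _ ξ
  obtain ⟨β, rfl⟩ := Submodule.Quotient.mk_surjective _ ξ'
  rw [Submodule.Quotient.eq, Submodule.mem_span_singleton]
  have e6 : ∀ u : F × F, (α - β) ((a.jet.D v').inverse (0, u)) = 0 := by
    intro u
    have h3 := congrArg (fun A => A u.1) e5
    have h4 := congrArg (fun A => A u.2) e3
    change β ((a.jet.D v').inverse (0, (u.1, 0))) = α ((a.jet.D v').inverse (0, (u.1, 0))) at h3
    change β ((a.jet.D v').inverse (0, (0, u.2))) = α ((a.jet.D v').inverse (0, (0, u.2))) at h4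
    have h5 : ((0 : ℝ), u) = (0, (u.1, 0)) + (0, (0, u.2)) := by simp
    change α _ - β _ = 0
    rw [h5]
    simp only [map_add, h3, h4, sub_self]
  refine ⟨(α - β) ((a.jet.D v').inverse (1, 0)), ?_⟩
  refine ContinuousLinearMap.ext fun w => ?_
  have h6 : w = (a.jet.D v').inverse ((a.jet.D v' w).1 • (1, 0) + (0, (a.jet.D v' w).2)) := by
    conv_lhs => rw [← a.jet.D_inverse_D (x := v') hm w]
    simp
  have h7 : (α - β) w = (a.jet.D v' w).1 • (α - β) ((a.jet.D v').inverse (1, 0)) := by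
    conv_lhs => rw [h6]
    rw [map_add, map_smul, map_add, map_smul, e6, add_zero]
  rw [h7, a.jet.fst_D (x := v') hm]
  exact mul_comm _ _

theorem tulczyjewInv_surjective : Function.Surjective (tulczyjewInv (π := π)) := by
  intro z
  let a := π.chartAround z.pt.pt
  have ha : z.pt.pt ∈ a.chart.source := π.mem_chartAround z.pt.pt
  let p := a.dual.jet.chart z
  let v : Jet π := a.jet.chart.symm (p.1, (p.2.1.1, p.2.2.1))
  have hp : (p.1, (p.2.1.1, p.2.2.1)) ∈ a.jet.chart.target := a.chart.map_source ha
  have hv : v ∈ a.jet.chart.source := a.jet.chart.map_target hp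
  have hvpt : v.pt = z.pt.pt := a.chart.left_inv ha
  let α : TangentSpace 𝓘(ℝ, ℝ × (F × F)) v →L[ℝ] ℝ :=
    (p.2.2.2.coprod p.2.1.2) ∘L ContinuousLinearMap.snd ℝ ℝ (F × F) ∘L a.jet.D v
  refine ⟨⟨v, Submodule.Quotient.mk α⟩, ?_⟩
  apply a.dual.jet.chart.injOn
    (show (tulczyjewInv _).pt.pt ∈ a.chart.source by rw [tulczyjewInv_pt, hvpt]; exact ha) ha
  rw [a.chart_tulczyjewInv v hv (Submodule.Quotient.mk α)]
  have h4 : a.jet.chart v = (p.1, (p.2.1.1, p.2.2.1)) := a.jet.chart.right_inv hp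
  have h5 : a.momenta (v := v) hv (Submodule.Quotient.mk α) = p.2.2.2.coprod p.2.1.2 := by
    refine ContinuousLinearMap.ext fun u => ?_
    change (p.2.2.2.coprod p.2.1.2) (a.jet.D v ((a.jet.D v).inverse (0, u))).2 = _
    rw [a.jet.D_D_inverse (x := v) hv]
  change ((a.jet.chart v).1, (((a.jet.chart v).2.1, a.momenta (v := v) hv _ ∘L _),
    ((a.jet.chart v).2.2, a.momenta (v := v) hv _ ∘L _))) = p
  rw [h4, h5]
  simp

variable (π) in
/-- The canonical Tulczyjew map `A_π : J^1π_1^* → T^*(J^1π)/⟨η_1⟩`,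
`(t, q, p; q̇, ṗ) ↦ (t, q, q̇; ṗ, p)`. -/
def tulczyjew : Jet π.dual ≃ RedCotangent π :=
  (Equiv.ofBijective tulczyjewInv ⟨tulczyjewInv_injective, tulczyjewInv_surjective⟩).symm

end

/-- A smooth local section of `π`, defined on the open set `dom`. Values of `toFun` outside `dom` are
irrelevant. -/
structure LocalSection (π : Fibration F M) where
  dom : Set ℝ
  isOpen_dom : IsOpen dom
  toFun : ℝ → M
  contMDiffOn : ContMDiffOn 𝓘(ℝ, ℝ) 𝓘(ℝ, ℝ × F) ∞ toFun dom
  section_eq : ∀ t ∈ dom, π (toFun t) = t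

instance (π : Fibration F M) : CoeFun (LocalSection π) (fun _ => ℝ → M) := ⟨LocalSection.toFun⟩

namespace LocalSection

variable {π : Fibration F M} (σ : LocalSection π)

theorem contMDiffAt {t : ℝ} (ht : t ∈ σ.dom) : ContMDiffAt 𝓘(ℝ, ℝ) 𝓘(ℝ, ℝ × F) ∞ σ t :=
  σ.contMDiffOn.contMDiffAt (σ.isOpen_dom.mem_nhds ht)

/-- The velocity of the curve. -/
def vel (t : ℝ) : TangentSpace 𝓘(ℝ, ℝ × F) (σ t) :=
  mfderiv 𝓘(ℝ, ℝ) 𝓘(ℝ, ℝ × F) σ t (1 : ℝ)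

theorem eta_vel {t : ℝ} (ht : t ∈ σ.dom) : π.eta (σ t) (σ.vel t) = 1 := by
  have h1 : (fun s => π (σ s)) =ᶠ[𝓝 t] id :=
    Filter.eventually_of_mem (σ.isOpen_dom.mem_nhds ht) σ.section_eq
  have h2 : mfderiv 𝓘(ℝ, ℝ) 𝓘(ℝ, ℝ) (fun s => π (σ s)) t
      = (mfderiv 𝓘(ℝ, ℝ × F) 𝓘(ℝ, ℝ) π (σ t)).comp (mfderiv 𝓘(ℝ, ℝ) 𝓘(ℝ, ℝ × F) σ t) :=
    mfderiv_comp t ((π.contMDiff _).mdifferentiableAt (by simp))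
      ((σ.contMDiffAt ht).mdifferentiableAt (by simp))
  rw [h1.mfderiv_eq, mfderiv_id] at h2
  exact (congrArg (fun A => A (1 : ℝ)) h2).symm

/-- The jet prolongation `j^1σ`. On `dom` it is the velocity of `σ`, see `j1_eq`. -/
def j1 (t : ℝ) : Jet π := Jet.normalize π (σ t) (σ.vel t)

theorem j1_eq {t : ℝ} (ht : t ∈ σ.dom) : σ.j1 t = ⟨σ t, σ.vel t, σ.eta_vel ht⟩ :=
  Jet.normalize_of_eq _ _ _ _

end LocalSection

section

variable [FiniteDimensional ℝ F] [IsManifold 𝓘(ℝ, ℝ × F) ∞ M] {π : Fibration F M}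

theorem LocalSection.contMDiffAt_j1 (σ : LocalSection π) {t : ℝ} (ht : t ∈ σ.dom) :
    ContMDiffAt 𝓘(ℝ, ℝ) 𝓘(ℝ, ℝ × (F × F)) ∞ σ.j1 t := by
  let a := π.chartAround (σ t)
  have ha : σ t ∈ a.chart.source := π.mem_chartAround _
  let U : Set ℝ := σ.dom ∩ σ ⁻¹' a.chart.source
  have hU : IsOpen U := σ.contMDiffOn.continuousOn.isOpen_inter_preimage σ.isOpen_dom
    a.chart.open_source
  have htU : t ∈ U := ⟨ht, ha⟩
  let c : ℝ → ℝ × F := fun s => a.chart (σ s)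
  have hc : ContDiffOn ℝ ∞ c U := by
    rw [← contMDiffOn_iff_contDiffOn]
    exact (contMDiffOn_of_mem_maximalAtlas a.mem_maximalAtlas).comp
      (σ.contMDiffOn.mono fun _ h => h.1) fun _ h => h.2
  have hd : ContDiffOn ℝ ∞ (fun s => fderiv ℝ c s 1) U :=
    (hc.fderiv_of_isOpen hU (m := ∞) (by simp)).clm_apply contDiffOn_const
  have hD : ∀ s ∈ U, a.D (σ s) (σ.vel s) = fderiv ℝ c s 1 := by
    intro s hs
    have h2 : mfderiv 𝓘(ℝ, ℝ) 𝓘(ℝ, ℝ × F) c s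
        = (mfderiv 𝓘(ℝ, ℝ × F) 𝓘(ℝ, ℝ × F) a.chart (σ s)).comp
          (mfderiv 𝓘(ℝ, ℝ) 𝓘(ℝ, ℝ × F) σ s) :=
      mfderiv_comp s (a.mdifferentiable.mdifferentiableAt hs.2)
        ((σ.contMDiffAt hs.1).mdifferentiableAt (by simp))
    rw [mfderiv_eq_fderiv] at h2
    rw [h2]; rfl
  let k : ℝ → ℝ × (F × F) := fun s => ((c s).1, ((c s).2, (fderiv ℝ c s 1).2))
  have hk : ContDiffOn ℝ ∞ k U := hc.fst.prodMk (hc.snd.prodMk hd.snd)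
  have hj : ∀ s ∈ U, a.jet.chart (σ.j1 s) = k s := by
    intro s hs
    rw [σ.j1_eq hs.1]
    change ((a.chart (σ s)).1, ((a.chart (σ s)).2, (a.D (σ s) (σ.vel s)).2)) = _
    rw [hD s hs]
  have hsrc : ∀ s ∈ U, σ.j1 s ∈ a.jet.chart.source := fun s hs => hs.2
  have hkt : ∀ s ∈ U, k s ∈ a.jet.chart.target := fun s hs => by
    rw [← hj s hs]; exact a.jet.chart.map_source (hsrc s hs)
  have hfin : ContMDiffOn 𝓘(ℝ, ℝ) 𝓘(ℝ, ℝ × (F × F)) ∞ (a.jet.chart.symm ∘ k) U :=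
    (contMDiffOn_symm_of_mem_maximalAtlas a.jet.mem_maximalAtlas).comp hk.contMDiffOn hkt
  refine (hfin.contMDiffAt (hU.mem_nhds htU)).congr_of_eventuallyEq ?_
  refine Filter.eventually_of_mem (hU.mem_nhds htU) fun s hs => ?_
  rw [Function.comp_apply, ← hj s hs, a.jet.chart.left_inv (hsrc s hs)]

/-- The affine action `(v, X) ↦ v + X` of vertical vectors on jets. -/
def Jet.add (v : Jet π) (X : π.Vert v.pt) : Jet π where
  pt := v.pt
  vel := v.vel + X
  eta_vel := by
    have hX : π.eta v.pt X = 0 := X.2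
    rw [map_add, v.eta_vel, hX, add_zero]

/-- The restricted Legendre transformation `leg_L(v)(X) = d/ds L(v + s X)` at `s = 0`. -/
def legendre (L : Jet π → ℝ) (v : Jet π) : VDual π :=
  ⟨v.pt, fderiv ℝ (fun X : π.Vert v.pt => L (v.add X)) 0⟩

/-- The Lagrangian in the coordinates `(t, (q, q̇))`. -/
def AdaptedChart.localLagrangian (a : AdaptedChart π) (L : Jet π → ℝ) : ℝ × (F × F) → ℝ :=
  fun p => L (a.jet.chart.symm p)

/-- The covector `∂L/∂q` at the coordinates `p = (t, (q, q̇))`. -/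
def AdaptedChart.dLdq (a : AdaptedChart π) (L : Jet π → ℝ) (p : ℝ × (F × F)) : F →L[ℝ] ℝ :=
  fderiv ℝ (fun q => a.localLagrangian L (p.1, (q, p.2.2))) p.2.1

/-- The covector `∂L/∂q̇` at the coordinates `p = (t, (q, q̇))`. -/
def AdaptedChart.dLdv (a : AdaptedChart π) (L : Jet π → ℝ) (p : ℝ × (F × F)) : F →L[ℝ] ℝ :=
  fderiv ℝ (fun w => a.localLagrangian L (p.1, (p.2.1, w))) p.2.2

theorem AdaptedChart.contDiffOn_localLagrangian (a : AdaptedChart π) {L : Jet π → ℝ}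
    (hL : ContMDiff 𝓘(ℝ, ℝ × (F × F)) 𝓘(ℝ, ℝ) ∞ L) :
    ContDiffOn ℝ ∞ (a.localLagrangian L) a.jet.chart.target := by
  rw [← contMDiffOn_iff_contDiffOn]
  exact hL.comp_contMDiffOn (contMDiffOn_symm_of_mem_maximalAtlas a.jet.mem_maximalAtlas)

theorem AdaptedChart.hasFDerivAt_localLagrangian (a : AdaptedChart π) {L : Jet π → ℝ}
    (hL : ContMDiff 𝓘(ℝ, ℝ × (F × F)) 𝓘(ℝ, ℝ) ∞ L) {p : ℝ × (F × F)}
    (hp : p ∈ a.jet.chart.target) :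
    HasFDerivAt (a.localLagrangian L) (fderiv ℝ (a.localLagrangian L) p) p :=
  (((a.contDiffOn_localLagrangian hL).contDiffAt (a.jet.chart.open_target.mem_nhds hp)
    ).differentiableAt (by simp)).hasFDerivAt

theorem AdaptedChart.dLdv_eq (a : AdaptedChart π) {L : Jet π → ℝ}
    (hL : ContMDiff 𝓘(ℝ, ℝ × (F × F)) 𝓘(ℝ, ℝ) ∞ L) {p : ℝ × (F × F)}
    (hp : p ∈ a.jet.chart.target) :
    a.dLdv L p = fderiv ℝ (a.localLagrangian L) p ∘L ContinuousLinearMap.inr ℝ ℝ (F × F) ∘L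
      ContinuousLinearMap.inr ℝ F F := by
  have h1 : HasFDerivAt (fun w : F => (p.1, (p.2.1, w)))
      (ContinuousLinearMap.inr ℝ ℝ (F × F) ∘L ContinuousLinearMap.inr ℝ F F) p.2.2 :=
    ((hasFDerivAt_const p.1 p.2.2).prodMk ((hasFDerivAt_const p.2.1 p.2.2).prodMk
      (hasFDerivAt_id p.2.2))).congr_fderiv rfl
  exact ((a.hasFDerivAt_localLagrangian hL hp).comp (f := fun w : F => (p.1, (p.2.1, w)))
    p.2.2 h1).fderiv

theorem fderiv_comp_add {V : Submodule ℝ (ℝ × F)} (K : V →L[ℝ] F) (g : F → ℝ) (w : F)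
    (hg : DifferentiableAt ℝ g w) :
    fderiv ℝ (fun X : V => g (w + K X)) 0 = fderiv ℝ g w ∘L K := by
  have h1 : HasFDerivAt (fun X : V => w + K X) K 0 := K.hasFDerivAt.const_add w
  have h2 : HasFDerivAt g (fderiv ℝ g w) (w + K 0) := by
    rw [map_zero, add_zero]; exact hg.hasFDerivAt
  exact (h2.comp (f := fun X : V => w + K X) 0 h1).fderiv

theorem AdaptedChart.jet_chart_add (a : AdaptedChart π) {v : Jet π} (X : π.Vert v.pt) :
    a.jet.chart (v.add X) = ((a.chart v.pt).1, ((a.chart v.pt).2,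
      (a.D v.pt v.vel).2 + (a.D v.pt X).2)) := by
  change ((a.chart v.pt).1, ((a.chart v.pt).2, (a.D v.pt (v.vel + X)).2)) = _
  rw [map_add]; rfl

theorem AdaptedChart.dual_chart_legendre (a : AdaptedChart π) {L : Jet π → ℝ}
    (hL : ContMDiff 𝓘(ℝ, ℝ × (F × F)) 𝓘(ℝ, ℝ) ∞ L) {v : Jet π} (hv : v.pt ∈ a.chart.source) :
    a.dual.chart (legendre L v) = ((a.chart v.pt).1, ((a.chart v.pt).2,
      a.dLdv L (a.jet.chart v))) := by
  have hv' : v ∈ a.jet.chart.source := hv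
  refine Prod.ext rfl (Prod.ext rfl ?_)
  refine ContinuousLinearMap.ext fun y => ?_
  change fderiv ℝ (fun X : π.Vert v.pt => L (v.add X)) 0
    (π.vertProj v.pt ((a.D v.pt).inverse (0, y))) = _
  rw [π.vertProj_coe _ _ (a.fst_D_inverse hv (0, y))]
  let p := a.jet.chart v
  let K : π.Vert v.pt →L[ℝ] F :=
    ContinuousLinearMap.snd ℝ ℝ F ∘L a.D v.pt ∘L (π.Vert v.pt).subtypeL
  have hp : p ∈ a.jet.chart.target := a.jet.chart.map_source hv'
  have h1 : (fun X : π.Vert v.pt => L (v.add X)) =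
      fun X => (fun w => a.localLagrangian L (p.1, (p.2.1, w))) (p.2.2 + K X) := by
    funext X
    have h2 : v.add X ∈ a.jet.chart.source := hv
    change L (v.add X) = L (a.jet.chart.symm
      ((a.chart v.pt).1, ((a.chart v.pt).2, (a.D v.pt v.vel).2 + (a.D v.pt X).2)))
    rw [← a.jet_chart_add X, a.jet.chart.left_inv h2]
  have hd : DifferentiableAt ℝ (fun w => a.localLagrangian L (p.1, (p.2.1, w))) p.2.2 := by
    have h3 : DifferentiableAt ℝ (fun w : F => (p.1, (p.2.1, w))) p.2.2 := by fun_prop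
    exact DifferentiableAt.comp (g := a.localLagrangian L) (f := fun w : F => (p.1, (p.2.1, w)))
      p.2.2 (a.hasFDerivAt_localLagrangian hL hp).differentiableAt h3
  have h4 := fderiv_comp_add (V := π.Vert v.pt) K
    (fun w => a.localLagrangian L (p.1, (p.2.1, w))) p.2.2 hd
  rw [h1]
  have h5 := DFunLike.congr_fun h4
    (⟨(a.D v.pt).inverse (0, y), a.fst_D_inverse hv (0, y)⟩ : π.Vert v.pt)
  refine Eq.trans h5 ?_
  change a.dLdv L p (a.D v.pt ((a.D v.pt).inverse (0, y))).2 = _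
  rw [a.D_D_inverse hv]

theorem contMDiff_legendre {L : Jet π → ℝ}
    (hL : ContMDiff 𝓘(ℝ, ℝ × (F × F)) 𝓘(ℝ, ℝ) ∞ L) :
    ContMDiff 𝓘(ℝ, ℝ × (F × F)) 𝓘(ℝ, ℝ × (F × (F →L[ℝ] ℝ))) ∞ (legendre L) := by
  intro v
  let a := π.chartAround v.pt
  have hv : v.pt ∈ a.chart.source := π.mem_chartAround _
  have hv' : v ∈ a.jet.chart.source := hv
  let k : ℝ × (F × F) → ℝ × (F × (F →L[ℝ] ℝ)) := fun p => (p.1, (p.2.1, a.dLdv L p))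
  have hk : ContDiffOn ℝ ∞ k a.jet.chart.target := by
    have h1 : ContDiffOn ℝ ∞ (a.dLdv L) a.jet.chart.target := by
      refine ContDiffOn.congr ?_ fun p hp => a.dLdv_eq hL hp
      exact ((a.contDiffOn_localLagrangian hL).fderiv_of_isOpen a.jet.chart.open_target
        (m := ∞) (by simp)).clm_comp contDiffOn_const
    exact contDiffOn_fst.prodMk (contDiff_snd.fst.contDiffOn.prodMk h1)
  have hl : ∀ w ∈ a.jet.chart.source, a.dual.chart (legendre L w) = k (a.jet.chart w) :=
    fun w hw => a.dual_chart_legendre hL hw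
  have hfin : ContMDiffOn 𝓘(ℝ, ℝ × (F × F)) 𝓘(ℝ, ℝ × (F × (F →L[ℝ] ℝ))) ∞
      (a.dual.chart.symm ∘ k ∘ a.jet.chart) a.jet.chart.source := by
    refine (contMDiffOn_symm_of_mem_maximalAtlas a.dual.mem_maximalAtlas).comp
      (hk.contMDiffOn.comp (contMDiffOn_of_mem_maximalAtlas a.jet.mem_maximalAtlas)
        fun w hw => a.jet.chart.map_source hw) fun w hw => ?_
    change k (a.jet.chart w) ∈ a.dual.chart.target
    rw [← hl w hw]
    exact a.dual.chart.map_source (show (legendre L w).pt ∈ a.chart.source from hw)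
  refine (hfin.contMDiffAt (a.jet.chart.open_source.mem_nhds hv')).congr_of_eventuallyEq ?_
  refine Filter.eventually_of_mem (a.jet.chart.open_source.mem_nhds hv') fun w hw => ?_
  rw [Function.comp_apply, Function.comp_apply, ← hl w hw, a.dual.chart.left_inv
    (show (legendre L w).pt ∈ a.chart.source from hw)]

/-- The local section `leg_L ∘ j^1σ` of `π_1^*`. -/
def LocalSection.leg (σ : LocalSection π) (L : Jet π → ℝ)
    (hL : ContMDiff 𝓘(ℝ, ℝ × (F × F)) 𝓘(ℝ, ℝ) ∞ L) : LocalSection π.dual where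
  dom := σ.dom
  isOpen_dom := σ.isOpen_dom
  toFun t := legendre L (σ.j1 t)
  contMDiffOn t ht :=
    ((contMDiff_legendre hL _).comp t (σ.contMDiffAt_j1 ht)).contMDiffWithinAt
  section_eq := σ.section_eq

/-- The local section of `π` under a local section `τ` of `π_1^*`. -/
def LocalSection.base (τ : LocalSection π.dual) : LocalSection π where
  dom := τ.dom
  isOpen_dom := τ.isOpen_dom
  toFun t := (τ t).pt
  section_eq := τ.section_eq
  contMDiffOn t ht := by
    refine ContMDiffAt.contMDiffWithinAt ?_
    refine ContMDiffAt.comp (g := VDual.pt) t ?_ (τ.contMDiffAt ht)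
    let a := π.chartAround (τ t).pt
    have ha : (τ t).pt ∈ a.chart.source := π.mem_chartAround _
    have ha' : τ t ∈ a.dual.chart.source := ha
    let k : ℝ × (F × (F →L[ℝ] ℝ)) → ℝ × F := fun p => (p.1, p.2.1)
    have hk : ContDiff ℝ ∞ k := by fun_prop
    have hfin : ContMDiffOn 𝓘(ℝ, ℝ × (F × (F →L[ℝ] ℝ))) 𝓘(ℝ, ℝ × F) ∞
        (a.chart.symm ∘ k ∘ a.dual.chart) a.dual.chart.source :=
      (contMDiffOn_symm_of_mem_maximalAtlas a.mem_maximalAtlas).comp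
        (hk.contMDiff.comp_contMDiffOn (contMDiffOn_of_mem_maximalAtlas a.dual.mem_maximalAtlas))
        fun w hw => a.chart.map_source hw
    refine (hfin.contMDiffAt (a.dual.chart.open_source.mem_nhds ha')).congr_of_eventuallyEq ?_
    refine Filter.eventually_of_mem (a.dual.chart.open_source.mem_nhds ha') fun w hw => ?_
    exact (a.chart.left_inv hw).symm

/-- `σ` solves the Euler-Lagrange equations `d/dt (∂L/∂q̇) = ∂L/∂q` along `j^1σ`, in every adapted
chart. -/
def IsEulerLagrangeSolution (L : Jet π → ℝ) (σ : LocalSection π) : Prop :=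
  ∀ a : AdaptedChart π, ∀ t ∈ σ.dom, σ t ∈ a.chart.source →
    HasDerivAt (fun s => a.dLdv L (a.jet.chart (σ.j1 s))) (a.dLdq L (a.jet.chart (σ.j1 t))) t

/-- The section `d̃L` of `T^*(J^1π)/⟨η_1⟩` induced by `dL`. -/
def dTilde (L : Jet π → ℝ) (v : Jet π) : RedCotangent π :=
  ⟨v, Submodule.Quotient.mk (mfderiv 𝓘(ℝ, ℝ × (F × F)) 𝓘(ℝ, ℝ) L v)⟩

/-- `S_L = A_π⁻¹(d̃L(J^1π))`. -/
def SL (L : Jet π → ℝ) : Set (Jet π.dual) := tulczyjew π ⁻¹' Set.range (dTilde L)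

/-- The functions `(p - ∂L/∂q̇, ṗ - ∂L/∂q)` in the coordinates `(t, ((q, p), (q̇, ṗ)))` of
`J^1π_1^*`. -/
def AdaptedChart.elEquations (a : AdaptedChart π) (L : Jet π → ℝ)
    (p : ℝ × ((F × (F →L[ℝ] ℝ)) × (F × (F →L[ℝ] ℝ)))) : (F →L[ℝ] ℝ) × (F →L[ℝ] ℝ) :=
  (p.2.1.2 - a.dLdv L (p.1, (p.2.1.1, p.2.2.1)), p.2.2.2 - a.dLdq L (p.1, (p.2.1.1, p.2.2.1)))

end

/-- The space of the coordinates `(t, ((q, p), (q̇, ṗ)))` of `J^1π_1^*`. -/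
abbrev DoubleModel (n : ℕ) : Type :=
  ℝ × ((EuclideanSpace ℝ (Fin n) × (EuclideanSpace ℝ (Fin n) →L[ℝ] ℝ)) ×
    (EuclideanSpace ℝ (Fin n) × (EuclideanSpace ℝ (Fin n) →L[ℝ] ℝ)))

namespace DoubleModel

variable {n : ℕ}

/-- The coordinate vector `∂/∂q^i`. -/
def ddq (i : Fin n) : DoubleModel n := (0, ((EuclideanSpace.single i 1, 0), (0, 0)))
/-- The coordinate vector `∂/∂p_i`. -/
def ddp (i : Fin n) : DoubleModel n := (0, ((0, EuclideanSpace.proj i), (0, 0)))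
/-- The coordinate vector `∂/∂q̇^i`. -/
def ddqdot (i : Fin n) : DoubleModel n := (0, ((0, 0), (EuclideanSpace.single i 1, 0)))
/-- The coordinate vector `∂/∂ṗ_i`. -/
def ddpdot (i : Fin n) : DoubleModel n := (0, ((0, 0), (0, EuclideanSpace.proj i)))

/-- The map `Λ^♯(ξ) = Λ(ξ, ·)` of the Poisson structure
`Λ = ∂/∂q^i ∧ ∂/∂ṗ_i + ∂/∂q̇^i ∧ ∂/∂p_i` of `J^1π_1^*`, in adapted coordinates. -/
def sharp (n : ℕ) : (DoubleModel n →L[ℝ] ℝ) →ₗ[ℝ] DoubleModel n where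
  toFun ξ := ∑ i, (ξ (ddq i) • ddpdot i - ξ (ddpdot i) • ddq i
    + ξ (ddqdot i) • ddp i - ξ (ddp i) • ddqdot i)
  map_add' ξ ξ' := by
    rw [← Finset.sum_add_distrib]
    refine Finset.sum_congr rfl fun i _ => ?_
    simp only [add_apply, add_smul]
    abel
  map_smul' c ξ := by
    rw [RingHom.id_apply, Finset.smul_sum]
    refine Finset.sum_congr rfl fun i _ => ?_
    simp only [smul_apply, smul_eq_mul, mul_smul, smul_sub, smul_add]

end DoubleModel

/-- `T` is Lagrangian for the bivector `Λ(ξ, ζ) = ζ(Λ^♯ ξ)`: `Λ` vanishes on `(Λ^♯)⁻¹(T)`, and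
`T ∩ im Λ^♯` has half the dimension of `im Λ^♯`. -/
structure IsLagrangian {V : Type*} [NormedAddCommGroup V] [NormedSpace ℝ V]
    (sharp : (V →L[ℝ] ℝ) →ₗ[ℝ] V) (T : Submodule ℝ V) : Prop where
  isotropic : ∀ ξ ζ : V →L[ℝ] ℝ, sharp ξ ∈ T → sharp ζ ∈ T → ζ (sharp ξ) = 0
  finrank_eq : 2 * Module.finrank ℝ (T ⊓ LinearMap.range sharp : Submodule ℝ V) =
    Module.finrank ℝ (LinearMap.range sharp)

end Tulczyjew

end

open Tulczyjew

/-!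
In adapted coordinates the composite of `d̃L` with the inverse of `A_π` is
`(t, q, q̇) ↦ (t, q, ∂L/∂q̇; q̇, ∂L/∂q)` (`AdaptedChart.chart_tulczyjew_symm_dTilde`). Hence `S_L` is
the zero set of `(p - ∂L/∂q̇, ṗ - ∂L/∂q)`. The coordinates of `j^1τ`, for a section `τ` of `π_1^*`,
are those of `τ` together with their time derivatives, so that `j^1τ` lies in `S_L` exactly when
`p = ∂L/∂q̇` and `dp/dt = ∂L/∂q` along the underlying section (`LocalSection.j1_mem_SL_iff`).

For `τ = leg_L ∘ j^1σ` the first equation is an identity and the second is the Euler-Lagrange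
equation of `σ`. Moreover a point of `S_L` comes from a single jet, whose coordinates `(t, q, q̇)` can
be read off, so that `j^1τ ∈ S_L` is the equality of the two curves in the first part of the theorem.
For a general `τ` the first equation says that `τ = leg_L ∘ j^1σ`, where `σ` underlies `τ`, which
reduces the last part to this case.

The tangent spaces of `S_L` are the graphs `δp = H(δt, δq, δq̇)|_q̇`, `δṗ = H(δt, δq, δq̇)|_q` of the
Hessian `H` of the local Lagrangian. On vectors with `δt = 0`, which form the image of `Λ^♯`, the
bivector is the antisymmetrization of `⟨δṗ, δ'q⟩ + ⟨δp, δ'q̇⟩ = H(δ, δ')`, and this is zero because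
`H` is symmetric. Such vectors of the graph are parametrized by `(δq, δq̇)`, so that they form a space
of dimension `2n`, half of that of the image (`DoubleModel.isLagrangian_of_symm`).
-/

namespace Tulczyjew

/-! ### Adapted charts and local sections -/

section Coordinates

variable {F : Type*} [NormedAddCommGroup F] [NormedSpace ℝ F]
  {M : Type*} [TopologicalSpace M] [ChartedSpace (ℝ × F) M] {π : Fibration F M}

/-- Differentials of functions are computed in a chart, since `(a.D x).inverse` is the differential
of the inverse of the chart. -/
theorem AdaptedChart.mfderiv_comp_D_inverse (a : AdaptedChart π) {f : M → ℝ} {x : M}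
    (hx : x ∈ a.chart.source) (hf : MDifferentiableAt 𝓘(ℝ, ℝ × F) 𝓘(ℝ, ℝ) f x) (w : ℝ × F) :
    mfderiv 𝓘(ℝ, ℝ × F) 𝓘(ℝ, ℝ) f x ((a.D x).inverse w) =
      fderiv ℝ (fun u => f (a.chart.symm u)) (a.chart x) w := by
  have ht := a.chart.map_source hx
  have hinv : (a.D x).inverse w =
      mfderiv 𝓘(ℝ, ℝ × F) 𝓘(ℝ, ℝ × F) a.chart.symm (a.chart x) w := by
    have h4 := congrArg (fun A => A w) (a.mdifferentiable.comp_symm_deriv ht)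
    have hs : a.chart.symm (a.chart x) = x := a.chart.left_inv hx
    rw [hs] at h4
    have h5 := a.D_inverse_D hx
      (mfderiv 𝓘(ℝ, ℝ × F) 𝓘(ℝ, ℝ × F) a.chart.symm (a.chart x) w)
    refine Eq.trans ?_ h5
    exact congrArg (a.D x).inverse h4.symm
  have hf' : MDifferentiableAt 𝓘(ℝ, ℝ × F) 𝓘(ℝ, ℝ) f (a.chart.symm (a.chart x)) := by
    rw [a.chart.left_inv hx]; exact hf
  have h2 : mfderiv 𝓘(ℝ, ℝ × F) 𝓘(ℝ, ℝ) (fun u => f (a.chart.symm u)) (a.chart x)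
      = (mfderiv 𝓘(ℝ, ℝ × F) 𝓘(ℝ, ℝ) f (a.chart.symm (a.chart x))).comp
        (mfderiv 𝓘(ℝ, ℝ × F) 𝓘(ℝ, ℝ × F) a.chart.symm (a.chart x)) :=
    mfderiv_comp (a.chart x) hf' (a.mdifferentiable.mdifferentiableAt_symm ht)
  rw [mfderiv_eq_fderiv] at h2
  rw [h2, hinv]
  have hs : a.chart.symm (a.chart x) = x := a.chart.left_inv hx
  rw [hs]
  rfl

theorem LocalSection.fst_chart (σ : LocalSection π) (a : AdaptedChart π) {t : ℝ} (ht : t ∈ σ.dom)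
    (ha : σ t ∈ a.chart.source) : (a.chart (σ t)).1 = t := by
  rw [a.fst_eq _ ha, σ.section_eq t ht]

theorem LocalSection.eventually_mem (σ : LocalSection π) (a : AdaptedChart π) {t : ℝ}
    (ht : t ∈ σ.dom) (ha : σ t ∈ a.chart.source) :
    ∀ᶠ s in 𝓝 t, s ∈ σ.dom ∧ σ s ∈ a.chart.source :=
  Filter.inter_mem (σ.isOpen_dom.mem_nhds ht)
    ((σ.contMDiffAt ht).continuousAt.preimage_mem_nhds (a.chart.open_source.mem_nhds ha))

theorem LocalSection.hasDerivAt_chart (σ : LocalSection π) (a : AdaptedChart π) {t : ℝ}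
    (ht : t ∈ σ.dom) (ha : σ t ∈ a.chart.source) :
    HasDerivAt (fun s => a.chart (σ s)) (a.D (σ t) (σ.vel t)) t := by
  have h1 := (σ.contMDiffAt ht).mdifferentiableAt (by simp : (∞ : WithTop ℕ∞) ≠ 0)
  have h2 : mfderiv 𝓘(ℝ, ℝ) 𝓘(ℝ, ℝ × F) (fun s => a.chart (σ s)) t
      = (mfderiv 𝓘(ℝ, ℝ × F) 𝓘(ℝ, ℝ × F) a.chart (σ t)).comp
        (mfderiv 𝓘(ℝ, ℝ) 𝓘(ℝ, ℝ × F) σ t) :=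
    mfderiv_comp t (a.mdifferentiable.mdifferentiableAt ha) h1
  have h3 : DifferentiableAt ℝ (fun s => a.chart (σ s)) t :=
    mdifferentiableAt_iff_differentiableAt.1
      ((a.mdifferentiable.mdifferentiableAt ha).comp t h1)
  rw [mfderiv_eq_fderiv] at h2
  have h4 := h3.hasFDerivAt.hasDerivAt
  rw [h2] at h4
  exact h4

theorem LocalSection.j1_congr {σ τ : LocalSection π} {t : ℝ} (h : σ.toFun =ᶠ[𝓝 t] τ.toFun) :
    σ.j1 t = τ.j1 t := by
  have h0 : σ.toFun t = τ.toFun t := h.self_of_nhds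
  have h1 := h.mfderiv_eq (I := 𝓘(ℝ, ℝ)) (I' := 𝓘(ℝ, ℝ × F))
  unfold LocalSection.j1 LocalSection.vel
  rw [h1, h0]

end Coordinates

section EulerLagrange

variable {F : Type*} [NormedAddCommGroup F] [NormedSpace ℝ F] [FiniteDimensional ℝ F]
  {M : Type*} [TopologicalSpace M] [ChartedSpace (ℝ × F) M] [IsManifold 𝓘(ℝ, ℝ × F) ∞ M]
  {π : Fibration F M} {L : Jet π → ℝ}

/-! ### The local expression of the map `A_π⁻¹ ∘ d̃L` -/

theorem LocalSection.jet_chart_j1 (σ : LocalSection π) (a : AdaptedChart π) {t : ℝ}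
    (ht : t ∈ σ.dom) (ha : σ t ∈ a.chart.source) :
    a.jet.chart (σ.j1 t) = (t, ((a.chart (σ t)).2, (a.D (σ t) (σ.vel t)).2)) := by
  rw [σ.j1_eq ht]
  exact Prod.ext (σ.fst_chart a ht ha) rfl

theorem AdaptedChart.dLdq_eq (a : AdaptedChart π)
    (hL : ContMDiff 𝓘(ℝ, ℝ × (F × F)) 𝓘(ℝ, ℝ) ∞ L) {p : ℝ × (F × F)}
    (hp : p ∈ a.jet.chart.target) :
    a.dLdq L p = fderiv ℝ (a.localLagrangian L) p ∘L ContinuousLinearMap.inr ℝ ℝ (F × F) ∘L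
      ContinuousLinearMap.inl ℝ F F := by
  have h1 : HasFDerivAt (fun q : F => (p.1, (q, p.2.2)))
      (ContinuousLinearMap.inr ℝ ℝ (F × F) ∘L ContinuousLinearMap.inl ℝ F F) p.2.1 :=
    ((hasFDerivAt_const p.1 p.2.1).prodMk ((hasFDerivAt_id p.2.1).prodMk
      (hasFDerivAt_const p.2.2 p.2.1))).congr_fderiv rfl
  exact ((a.hasFDerivAt_localLagrangian hL hp).comp (f := fun q : F => (p.1, (q, p.2.2)))
    p.2.1 h1).fderiv

theorem AdaptedChart.momenta_dTilde (a : AdaptedChart π)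
    (hL : ContMDiff 𝓘(ℝ, ℝ × (F × F)) 𝓘(ℝ, ℝ) ∞ L) {v : Jet π} (hv : v.pt ∈ a.chart.source) :
    a.momenta hv (dTilde L v).2 =
      fderiv ℝ (a.localLagrangian L) (a.jet.chart v) ∘L ContinuousLinearMap.inr ℝ ℝ (F × F) :=
  ContinuousLinearMap.ext fun u =>
    a.jet.mfderiv_comp_D_inverse (x := v) hv ((hL v).mdifferentiableAt (by simp)) (0, u)

/-- The local expression `(t, q, q̇) ↦ (t, q, ∂L/∂q̇; q̇, ∂L/∂q)` of `A_π⁻¹ ∘ d̃L`. -/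
theorem AdaptedChart.chart_tulczyjew_symm_dTilde (a : AdaptedChart π)
    (hL : ContMDiff 𝓘(ℝ, ℝ × (F × F)) 𝓘(ℝ, ℝ) ∞ L) {v : Jet π} (hv : v.pt ∈ a.chart.source) :
    a.dual.jet.chart ((tulczyjew π).symm (dTilde L v)) =
      ((a.jet.chart v).1, (((a.jet.chart v).2.1, a.dLdv L (a.jet.chart v)),
        ((a.jet.chart v).2.2, a.dLdq L (a.jet.chart v)))) := by
  have hp : a.jet.chart v ∈ a.jet.chart.target := a.jet.chart.map_source (x := v) hv
  refine (a.chart_tulczyjewInv v hv (dTilde L v).2).trans ?_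
  have hm := a.momenta_dTilde hL hv
  exact Prod.ext rfl (Prod.ext
    (Prod.ext rfl ((congrArg (· ∘L ContinuousLinearMap.inr ℝ F F) hm).trans
      (a.dLdv_eq hL hp).symm))
    (Prod.ext rfl ((congrArg (· ∘L ContinuousLinearMap.inl ℝ F F) hm).trans
      (a.dLdq_eq hL hp).symm)))

theorem pt_tulczyjew_symm (ζ : RedCotangent π) : ((tulczyjew π).symm ζ).pt.pt = ζ.1.pt :=
  tulczyjewInv_pt ζ

/-! ### The Euler-Lagrange equations as membership in `S_L` -/

theorem mem_SL_iff {z : Jet π.dual} :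
    z ∈ SL L ↔ ∃ v, (tulczyjew π).symm (dTilde L v) = z := by
  simp only [SL, Set.mem_preimage, Set.mem_range, Equiv.symm_apply_eq]

theorem AdaptedChart.mem_SL_iff_elEquations (a : AdaptedChart π)
    (hL : ContMDiff 𝓘(ℝ, ℝ × (F × F)) 𝓘(ℝ, ℝ) ∞ L) {z : Jet π.dual}
    (hz : z ∈ a.dual.jet.chart.source) :
    z ∈ SL L ↔ a.elEquations L (a.dual.jet.chart z) = 0 := by
  have hz' : z.pt.pt ∈ a.chart.source := hz
  rw [mem_SL_iff]
  constructor
  · rintro ⟨v, rfl⟩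
    rw [pt_tulczyjew_symm] at hz'
    rw [a.chart_tulczyjew_symm_dTilde hL (v := v) hz']
    exact Prod.ext (sub_self _) (sub_self _)
  · intro h
    -- The jet with the same `(t, q, q̇)` is the only candidate.
    set p := a.dual.jet.chart z with hpz
    have hp : (p.1, (p.2.1.1, p.2.2.1)) ∈ a.jet.chart.target := a.chart.map_source hz'
    have hv : a.jet.chart.symm (p.1, (p.2.1.1, p.2.2.1)) ∈ a.jet.chart.source :=
      a.jet.chart.map_target hp
    refine ⟨a.jet.chart.symm (p.1, (p.2.1.1, p.2.2.1)), ?_⟩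
    apply a.dual.jet.chart.injOn _ hz
    · rw [a.chart_tulczyjew_symm_dTilde hL hv, a.jet.chart.right_inv hp, ← hpz]
      have h1 : p.2.1.2 = a.dLdv L (p.1, (p.2.1.1, p.2.2.1)) :=
        sub_eq_zero.1 (congrArg Prod.fst h)
      have h2 : p.2.2.2 = a.dLdq L (p.1, (p.2.1.1, p.2.2.1)) :=
        sub_eq_zero.1 (congrArg Prod.snd h)
      dsimp only
      rw [← h1, ← h2]
    · change ((tulczyjew π).symm _).pt.pt ∈ a.chart.source
      rw [pt_tulczyjew_symm]
      exact hv

/-- The velocities of a section of `π_1^*` and of the underlying section of `π` have the same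
coordinates `q̇`. -/
theorem LocalSection.fst_dual_D_vel (τ : LocalSection π.dual) (a : AdaptedChart π) {t : ℝ}
    (ht : t ∈ τ.dom) (ha : (τ t).pt ∈ a.chart.source) :
    (a.dual.D (τ t) (τ.vel t)).2.1 = (a.D (τ.base t) (τ.base.vel t)).2 := by
  have h1 : HasDerivAt (fun s => (a.chart (τ.base s)).2) (a.dual.D (τ t) (τ.vel t)).2.1 t :=
    (τ.hasDerivAt_chart a.dual ht ha).snd.fst
  have h2 : HasDerivAt (fun s => (a.chart (τ.base s)).2) (a.D (τ.base t) (τ.base.vel t)).2 t :=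
    (τ.base.hasDerivAt_chart a ht ha).snd
  exact h1.unique h2

/-- In coordinates, a section `τ` of `π_1^*` has the momenta `p = (a.dual.chart (τ s)).2.2`, and
`j^1τ` lies in `S_L` where `p = ∂L/∂q̇` and `dp/dt = ∂L/∂q` along the underlying section. -/
theorem LocalSection.j1_mem_SL_iff (τ : LocalSection π.dual) (a : AdaptedChart π)
    (hL : ContMDiff 𝓘(ℝ, ℝ × (F × F)) 𝓘(ℝ, ℝ) ∞ L) {t : ℝ} (ht : t ∈ τ.dom)
    (ha : (τ t).pt ∈ a.chart.source) :
    τ.j1 t ∈ SL L ↔ (a.dual.chart (τ t)).2.2 = a.dLdv L (a.jet.chart (τ.base.j1 t)) ∧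
      HasDerivAt (fun s => (a.dual.chart (τ s)).2.2) (a.dLdq L (a.jet.chart (τ.base.j1 t))) t := by
  have hd := τ.hasDerivAt_chart a.dual ht ha
  have hp : HasDerivAt (fun s => (a.dual.chart (τ s)).2.2)
      (a.dual.D (τ t) (τ.vel t)).2.2 t := hd.snd.snd
  have hq := τ.fst_dual_D_vel a ht ha
  rw [a.mem_SL_iff_elEquations hL (z := τ.j1 t) ha, τ.jet_chart_j1 a.dual ht ha,
    τ.base.jet_chart_j1 a ht ha, AdaptedChart.elEquations, Prod.mk_eq_zero, sub_eq_zero,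
    sub_eq_zero, hq]
  refine and_congr Iff.rfl ⟨fun h => ?_, fun h => hp.unique h⟩
  exact Eq.subst (motive := fun m => HasDerivAt _ m t) h hp

theorem AdaptedChart.dual_chart_leg (a : AdaptedChart π)
    (hL : ContMDiff 𝓘(ℝ, ℝ × (F × F)) 𝓘(ℝ, ℝ) ∞ L) (σ : LocalSection π) {t : ℝ}
    (ha : σ t ∈ a.chart.source) :
    (a.dual.chart (σ.leg L hL t)).2.2 = a.dLdv L (a.jet.chart (σ.j1 t)) :=
  congrArg (fun p => p.2.2) (a.dual_chart_legendre hL (v := σ.j1 t) ha)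

theorem isEulerLagrangeSolution_iff_leg_j1_mem_SL
    (hL : ContMDiff 𝓘(ℝ, ℝ × (F × F)) 𝓘(ℝ, ℝ) ∞ L) (σ : LocalSection π) :
    IsEulerLagrangeSolution L σ ↔ ∀ t ∈ σ.dom, (σ.leg L hL).j1 t ∈ SL L := by
  have key : ∀ (a : AdaptedChart π) (t : ℝ), t ∈ σ.dom → σ t ∈ a.chart.source →
      ((σ.leg L hL).j1 t ∈ SL L ↔ HasDerivAt (fun s => a.dLdv L (a.jet.chart (σ.j1 s)))
        (a.dLdq L (a.jet.chart (σ.j1 t))) t) := by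
    intro a t ht ha
    rw [(σ.leg L hL).j1_mem_SL_iff a hL ht ha]
    have hev : (fun s => (a.dual.chart (σ.leg L hL s)).2.2) =ᶠ[𝓝 t]
        fun s => a.dLdv L (a.jet.chart (σ.j1 s)) :=
      (σ.eventually_mem a ht ha).mono fun s hs => a.dual_chart_leg hL σ hs.2
    rw [hev.hasDerivAt_iff]
    exact and_iff_right (a.dual_chart_leg hL σ ha)
  exact ⟨fun h t ht => (key _ t ht (π.mem_chartAround _)).2 (h _ t ht (π.mem_chartAround _)),
    fun h a t ht ha => (key a t ht ha).1 (h t ht)⟩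

/-- If `j^1(leg_L ∘ j^1σ)` is the image under `A_π⁻¹ ∘ d̃L` of some jet, then that jet is `j^1σ`,
because `A_π⁻¹ ∘ d̃L` does not change the coordinates `(t, q, q̇)`. -/
theorem tulczyjew_symm_dTilde_eq_leg_j1_iff
    (hL : ContMDiff 𝓘(ℝ, ℝ × (F × F)) 𝓘(ℝ, ℝ) ∞ L) (σ : LocalSection π) {t : ℝ}
    (ht : t ∈ σ.dom) :
    (tulczyjew π).symm (dTilde L (σ.j1 t)) = (σ.leg L hL).j1 t ↔
      (σ.leg L hL).j1 t ∈ SL L := by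
  rw [mem_SL_iff]
  refine ⟨fun h => ⟨_, h⟩, ?_⟩
  rintro ⟨v, hv⟩
  suffices v = σ.j1 t by rw [← this, hv]
  let a := π.chartAround (σ t)
  have ha : σ t ∈ a.chart.source := π.mem_chartAround _
  have hpt : v.pt = σ t := (pt_tulczyjew_symm (dTilde L v)).symm.trans (congrArg (·.pt.pt) hv)
  have hva : v.pt ∈ a.chart.source := hpt ▸ ha
  have h1 := a.chart_tulczyjew_symm_dTilde hL hva
  rw [hv, (σ.leg L hL).jet_chart_j1 a.dual ht ha] at h1
  have hq : (a.dual.D (σ.leg L hL t) ((σ.leg L hL).vel t)).2.1 = (a.D (σ t) (σ.vel t)).2 :=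
    (σ.leg L hL).fst_dual_D_vel a ht ha
  apply a.jet.chart.injOn (show v ∈ a.jet.chart.source from hva)
    (show σ.j1 t ∈ a.jet.chart.source from ha)
  rw [σ.jet_chart_j1 a ht ha, ← hq]
  exact Prod.ext (congrArg (fun p => p.1) h1).symm (Prod.ext (congrArg (fun p => p.2.1.1) h1).symm
    (congrArg (fun p => p.2.2.1) h1).symm)

theorem LocalSection.eq_leg_of_j1_mem_SL (τ : LocalSection π.dual)
    (hL : ContMDiff 𝓘(ℝ, ℝ × (F × F)) 𝓘(ℝ, ℝ) ∞ L) {t : ℝ} (ht : t ∈ τ.dom)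
    (h : τ.j1 t ∈ SL L) : τ t = τ.base.leg L hL t := by
  let a := π.chartAround (τ t).pt
  have ha : (τ t).pt ∈ a.chart.source := π.mem_chartAround _
  apply a.dual.chart.injOn (show τ t ∈ a.dual.chart.source from ha)
    (show τ.base.leg L hL t ∈ a.dual.chart.source from ha)
  exact Prod.ext rfl (Prod.ext rfl
    (((τ.j1_mem_SL_iff a hL ht ha).1 h).1.trans (a.dual_chart_leg hL τ.base ha).symm))

theorem LocalSection.forall_j1_mem_SL_iff (τ : LocalSection π.dual)
    (hL : ContMDiff 𝓘(ℝ, ℝ × (F × F)) 𝓘(ℝ, ℝ) ∞ L) :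
    (∀ t ∈ τ.dom, τ.j1 t ∈ SL L) ↔
      IsEulerLagrangeSolution L τ.base ∧ ∀ t ∈ τ.dom, τ t = (τ.base.leg L hL) t := by
  have hj : (∀ t ∈ τ.dom, τ t = (τ.base.leg L hL) t) →
      ∀ t ∈ τ.dom, τ.j1 t = (τ.base.leg L hL).j1 t := fun h t ht =>
    LocalSection.j1_congr (Filter.eventually_of_mem (τ.isOpen_dom.mem_nhds ht) h)
  rw [isEulerLagrangeSolution_iff_leg_j1_mem_SL hL]
  constructor
  · intro h
    have he := fun t ht => τ.eq_leg_of_j1_mem_SL hL ht (h t ht)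
    exact ⟨fun t ht => hj he t ht ▸ h t ht, he⟩
  · rintro ⟨h, he⟩ t ht
    rw [hj he t ht]
    exact h t ht

/-! ### The differential of the Euler-Lagrange equations -/

/-- The projection `(t, q, p; q̇, ṗ) ↦ (t, q, q̇)` in coordinates. -/
noncomputable def jetProj (F : Type*) [NormedAddCommGroup F] [NormedSpace ℝ F] :
    ℝ × ((F × (F →L[ℝ] ℝ)) × (F × (F →L[ℝ] ℝ))) →L[ℝ] ℝ × (F × F) :=
  (ContinuousLinearMap.id ℝ ℝ).prodMap
    ((ContinuousLinearMap.fst ℝ F (F →L[ℝ] ℝ)).prodMap (ContinuousLinearMap.fst ℝ F (F →L[ℝ] ℝ)))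

theorem AdaptedChart.jetProj_mem_target (a : AdaptedChart π)
    {p : ℝ × ((F × (F →L[ℝ] ℝ)) × (F × (F →L[ℝ] ℝ)))} (hp : p ∈ a.dual.jet.chart.target) :
    jetProj F p ∈ a.jet.chart.target := hp

theorem AdaptedChart.elEquations_eq (a : AdaptedChart π)
    (hL : ContMDiff 𝓘(ℝ, ℝ × (F × F)) 𝓘(ℝ, ℝ) ∞ L)
    {p : ℝ × ((F × (F →L[ℝ] ℝ)) × (F × (F →L[ℝ] ℝ)))} (hp : p ∈ a.dual.jet.chart.target) :
    a.elEquations L p =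
      (p.2.1.2 - fderiv ℝ (a.localLagrangian L) (jetProj F p) ∘L
        ContinuousLinearMap.inr ℝ ℝ (F × F) ∘L ContinuousLinearMap.inr ℝ F F,
      p.2.2.2 - fderiv ℝ (a.localLagrangian L) (jetProj F p) ∘L
        ContinuousLinearMap.inr ℝ ℝ (F × F) ∘L ContinuousLinearMap.inl ℝ F F) :=
  Prod.ext (congrArg (p.2.1.2 - ·) (a.dLdv_eq hL (a.jetProj_mem_target hp)))
    (congrArg (p.2.2.2 - ·) (a.dLdq_eq hL (a.jetProj_mem_target hp)))

theorem AdaptedChart.contDiffOn_fderiv_localLagrangian (a : AdaptedChart π)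
    (hL : ContMDiff 𝓘(ℝ, ℝ × (F × F)) 𝓘(ℝ, ℝ) ∞ L) :
    ContDiffOn ℝ ∞ (fderiv ℝ (a.localLagrangian L)) a.jet.chart.target :=
  (a.contDiffOn_localLagrangian hL).fderiv_of_isOpen a.jet.chart.open_target (by simp)

theorem AdaptedChart.contDiffOn_elEquations (a : AdaptedChart π)
    (hL : ContMDiff 𝓘(ℝ, ℝ × (F × F)) 𝓘(ℝ, ℝ) ∞ L) :
    ContDiffOn ℝ ∞ (a.elEquations L) a.dual.jet.chart.target := by
  have h := (a.contDiffOn_fderiv_localLagrangian hL).comp (jetProj F).contDiff.contDiffOn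
    (s := a.dual.jet.chart.target) fun p hp => a.jetProj_mem_target hp
  refine ContDiffOn.congr ?_ fun p hp => a.elEquations_eq hL hp
  exact (contDiff_snd.fst.snd.contDiffOn.sub (h.clm_comp contDiffOn_const)).prodMk
    (contDiff_snd.snd.snd.contDiffOn.sub (h.clm_comp contDiffOn_const))

/-- The differential of the Euler-Lagrange equations is expressed by the Hessian of `L`. -/
theorem AdaptedChart.fderiv_elEquations (a : AdaptedChart π)
    (hL : ContMDiff 𝓘(ℝ, ℝ × (F × F)) 𝓘(ℝ, ℝ) ∞ L)
    {p : ℝ × ((F × (F →L[ℝ] ℝ)) × (F × (F →L[ℝ] ℝ)))} (hp : p ∈ a.dual.jet.chart.target)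
    (w : ℝ × ((F × (F →L[ℝ] ℝ)) × (F × (F →L[ℝ] ℝ)))) :
    fderiv ℝ (a.elEquations L) p w =
      (w.2.1.2 - fderiv ℝ (fderiv ℝ (a.localLagrangian L)) (jetProj F p) (jetProj F w) ∘L
        ContinuousLinearMap.inr ℝ ℝ (F × F) ∘L ContinuousLinearMap.inr ℝ F F,
      w.2.2.2 - fderiv ℝ (fderiv ℝ (a.localLagrangian L)) (jetProj F p) (jetProj F w) ∘L
        ContinuousLinearMap.inr ℝ ℝ (F × F) ∘L ContinuousLinearMap.inl ℝ F F) := by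
  have hev : a.elEquations L =ᶠ[𝓝 p] _ :=
    Filter.eventually_of_mem (a.dual.jet.chart.open_target.mem_nhds hp)
      fun p hp => a.elEquations_eq hL hp
  have h2 : HasFDerivAt (fderiv ℝ (a.localLagrangian L))
      (fderiv ℝ (fderiv ℝ (a.localLagrangian L)) (jetProj F p)) (jetProj F p) :=
    (((a.contDiffOn_fderiv_localLagrangian hL).contDiffAt (a.jet.chart.open_target.mem_nhds
      (a.jetProj_mem_target hp))).differentiableAt (by simp)).hasFDerivAt
  have hc := h2.comp p (jetProj F).hasFDerivAt
  have e1 := (hasFDerivAt_id (𝕜 := ℝ) p).snd.fst.snd.sub (hc.clm_comp (hasFDerivAt_const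
    (ContinuousLinearMap.inr ℝ ℝ (F × F) ∘L ContinuousLinearMap.inr ℝ F F) p))
  have e2 := (hasFDerivAt_id (𝕜 := ℝ) p).snd.snd.snd.sub (hc.clm_comp (hasFDerivAt_const
    (ContinuousLinearMap.inr ℝ ℝ (F × F) ∘L ContinuousLinearMap.inl ℝ F F) p))
  rw [((e1.prodMk e2).congr_of_eventuallyEq hev).fderiv]
  refine Prod.ext ?_ ?_ <;> refine ContinuousLinearMap.ext fun y => ?_ <;> simp

theorem AdaptedChart.fderiv_elEquations_surjective (a : AdaptedChart π)
    (hL : ContMDiff 𝓘(ℝ, ℝ × (F × F)) 𝓘(ℝ, ℝ) ∞ L)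
    {p : ℝ × ((F × (F →L[ℝ] ℝ)) × (F × (F →L[ℝ] ℝ)))} (hp : p ∈ a.dual.jet.chart.target) :
    Function.Surjective (fderiv ℝ (a.elEquations L) p) := by
  intro y
  -- The equations are affine in `(p, ṗ)`, with the identity as linear part.
  refine ⟨(0, ((0, y.1), (0, y.2))), ?_⟩
  have h0 : jetProj F (0, ((0, y.1), (0, y.2))) = 0 := rfl
  rw [a.fderiv_elEquations hL hp, h0, map_zero]
  simp

theorem AdaptedChart.isSymmSndFDerivAt_localLagrangian (a : AdaptedChart π)
    (hL : ContMDiff 𝓘(ℝ, ℝ × (F × F)) 𝓘(ℝ, ℝ) ∞ L) {p : ℝ × (F × F)}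
    (hp : p ∈ a.jet.chart.target) : IsSymmSndFDerivAt ℝ (a.localLagrangian L) p :=
  ((a.contDiffOn_localLagrangian hL).contDiffAt
    (a.jet.chart.open_target.mem_nhds hp)).isSymmSndFDerivAt
      (by simpa using! (WithTop.coe_le_coe.2 (le_top (a := (2 : ℕ∞)))))

end EulerLagrange

/-! ### Lagrangian subspaces for the Poisson structure -/

namespace DoubleModel

variable {n : ℕ}

theorem sharp_apply (ξ : DoubleModel n →L[ℝ] ℝ) :
    sharp n ξ = ∑ i, (ξ (ddq i) • ddpdot i - ξ (ddpdot i) • ddq i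
      + ξ (ddqdot i) • ddp i - ξ (ddp i) • ddqdot i) := rfl

theorem covector_apply (p : EuclideanSpace ℝ (Fin n) →L[ℝ] ℝ) (u : EuclideanSpace ℝ (Fin n)) :
    p u = ∑ i, u i * p (EuclideanSpace.single i 1) := by
  conv_lhs => rw [← (EuclideanSpace.basisFun (Fin n) ℝ).sum_repr u]
  simp

theorem covector_ext {p p' : EuclideanSpace ℝ (Fin n) →L[ℝ] ℝ}
    (h : ∀ i, p (EuclideanSpace.single i 1) = p' (EuclideanSpace.single i 1)) : p = p' :=
  ContinuousLinearMap.ext fun u => by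
    rw [covector_apply p, covector_apply p']; simp only [h]

theorem sharp_time (ξ : DoubleModel n →L[ℝ] ℝ) : (sharp n ξ).1 = 0 := by
  simp [sharp_apply, Prod.fst_sum, ddq, ddp, ddqdot, ddpdot]

theorem sharp_q (ξ : DoubleModel n →L[ℝ] ℝ) (i : Fin n) :
    (sharp n ξ).2.1.1 i = -ξ (ddpdot i) := by
  simp [sharp_apply, Prod.fst_sum, Prod.snd_sum, ddq, ddp, ddqdot, ddpdot, Pi.single_apply]

theorem sharp_p (ξ : DoubleModel n →L[ℝ] ℝ) (i : Fin n) :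
    (sharp n ξ).2.1.2 (EuclideanSpace.single i 1) = ξ (ddqdot i) := by
  simp [sharp_apply, Prod.fst_sum, Prod.snd_sum, ddq, ddp, ddqdot, ddpdot]

theorem sharp_qdot (ξ : DoubleModel n →L[ℝ] ℝ) (i : Fin n) :
    (sharp n ξ).2.2.1 i = -ξ (ddp i) := by
  simp [sharp_apply, Prod.fst_sum, Prod.snd_sum, ddq, ddp, ddqdot, ddpdot, Pi.single_apply]

theorem sharp_pdot (ξ : DoubleModel n →L[ℝ] ℝ) (i : Fin n) :
    (sharp n ξ).2.2.2 (EuclideanSpace.single i 1) = ξ (ddq i) := by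
  simp [sharp_apply, Prod.snd_sum, ddq, ddp, ddqdot, ddpdot]

theorem ext_coord {w w' : DoubleModel n} (h1 : w.1 = w'.1) (h2 : ∀ i, w.2.1.1 i = w'.2.1.1 i)
    (h3 : ∀ i, w.2.1.2 (EuclideanSpace.single i 1) = w'.2.1.2 (EuclideanSpace.single i 1))
    (h4 : ∀ i, w.2.2.1 i = w'.2.2.1 i)
    (h5 : ∀ i, w.2.2.2 (EuclideanSpace.single i 1) = w'.2.2.2 (EuclideanSpace.single i 1)) :
    w = w' :=
  Prod.ext h1 (Prod.ext (Prod.ext (PiLp.ext h2) (covector_ext h3))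
    (Prod.ext (PiLp.ext h4) (covector_ext h5)))

/-- On the image of `Λ^♯`, the bivector is the pairing of `(q, q̇)` with `(ṗ, p)`,
antisymmetrized. -/
theorem apply_sharp (ξ ζ : DoubleModel n →L[ℝ] ℝ) :
    ζ (sharp n ξ) =
      (sharp n ζ).2.2.2 (sharp n ξ).2.1.1 + (sharp n ζ).2.1.2 (sharp n ξ).2.2.1 -
      ((sharp n ξ).2.2.2 (sharp n ζ).2.1.1 + (sharp n ξ).2.1.2 (sharp n ζ).2.2.1) := by
  rw [covector_apply (sharp n ζ).2.2.2, covector_apply (sharp n ζ).2.1.2,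
    covector_apply (sharp n ξ).2.2.2, covector_apply (sharp n ξ).2.1.2]
  simp only [sharp_q, sharp_p, sharp_qdot, sharp_pdot]
  rw [← Finset.sum_add_distrib, ← Finset.sum_add_distrib, ← Finset.sum_sub_distrib, sharp_apply,
    map_sum]
  refine Finset.sum_congr rfl fun i _ => ?_
  simp only [map_add, map_sub, map_smul, smul_eq_mul]
  ring

theorem mem_range_sharp {w : DoubleModel n} : w ∈ LinearMap.range (sharp n) ↔ w.1 = 0 := by
  constructor
  · rintro ⟨ξ, rfl⟩
    exact sharp_time ξ
  · intro hw
    -- Up to sign, `ξ` is the pairing of `w` with the canonical two-form dual to `Λ`.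
    let ξ : DoubleModel n →L[ℝ] ℝ :=
      ((w.2.2.2.coprod (-ContinuousLinearMap.apply ℝ ℝ w.2.2.1)).coprod
        (w.2.1.2.coprod (-ContinuousLinearMap.apply ℝ ℝ w.2.1.1))) ∘L
          ContinuousLinearMap.snd ℝ ℝ _
    refine ⟨ξ, ext_coord ((sharp_time ξ).trans hw.symm) ?_ ?_ ?_ ?_⟩ <;> intro i
    · rw [sharp_q]; simp [ξ, ddpdot]
    · rw [sharp_p]; simp [ξ, ddqdot]
    · rw [sharp_qdot]; simp [ξ, ddp]
    · rw [sharp_pdot]; simp [ξ, ddq]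

theorem finrank_range_sharp : Module.finrank ℝ (LinearMap.range (sharp n)) = 4 * n := by
  have h : LinearMap.range (sharp n) = LinearMap.range (LinearMap.inr ℝ ℝ
      ((EuclideanSpace ℝ (Fin n) × (EuclideanSpace ℝ (Fin n) →L[ℝ] ℝ)) ×
        (EuclideanSpace ℝ (Fin n) × (EuclideanSpace ℝ (Fin n) →L[ℝ] ℝ)))) := by
    ext w
    rw [mem_range_sharp]
    constructor
    · intro hw
      exact ⟨w.2, Prod.ext hw.symm rfl⟩
    · rintro ⟨y, rfl⟩
      rfl
  have hd : Module.finrank ℝ (EuclideanSpace ℝ (Fin n) →L[ℝ] ℝ) = n := by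
    rw [← LinearEquiv.finrank_eq (LinearMap.toContinuousLinearMap
      (𝕜 := ℝ) (E := EuclideanSpace ℝ (Fin n)) (F' := ℝ))]
    simp
  rw [h, LinearMap.finrank_range_of_inj LinearMap.inr_injective]
  simp only [Module.finrank_prod, hd, finrank_euclideanSpace_fin]
  ring

/-- A linear subspace `p = ∂Q/∂q̇`, `ṗ = ∂Q/∂q`, where `Q` is a quadratic form in `(t, q, q̇)` with
the symmetric bilinear form `H`, is Lagrangian: on it the pairing of `apply_sharp` is `H`, so that
its antisymmetrization is zero, and its vectors with `t = 0` are parametrized by `(q, q̇)`. -/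
theorem isLagrangian_of_symm {T : Submodule ℝ (DoubleModel n)}
    (H : ℝ × (EuclideanSpace ℝ (Fin n) × EuclideanSpace ℝ (Fin n)) →L[ℝ]
      ℝ × (EuclideanSpace ℝ (Fin n) × EuclideanSpace ℝ (Fin n)) →L[ℝ] ℝ)
    (hH : ∀ u v, H u v = H v u)
    (hT : ∀ w, w ∈ T ↔
      w.2.1.2 = H (jetProj _ w) ∘L ContinuousLinearMap.inr ℝ ℝ _ ∘L
        ContinuousLinearMap.inr ℝ _ _ ∧
      w.2.2.2 = H (jetProj _ w) ∘L ContinuousLinearMap.inr ℝ ℝ _ ∘L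
        ContinuousLinearMap.inl ℝ _ _) :
    IsLagrangian (sharp n) T where
  isotropic ξ ζ hξ hζ := by
    have key : ∀ w ∈ T, ∀ w' : DoubleModel n, w'.1 = 0 →
        w.2.2.2 w'.2.1.1 + w.2.1.2 w'.2.2.1 = H (jetProj _ w) (jetProj _ w') := by
      intro w hw w' hw'
      rw [((hT w).1 hw).1, ((hT w).1 hw).2]
      refine ((H (jetProj _ w)).map_add (0, (w'.2.1.1, 0)) (0, (0, w'.2.2.1))).symm.trans ?_
      congr 1
      refine Prod.ext ?_ (Prod.ext (add_zero _) (zero_add _))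
      exact (add_zero _).trans hw'.symm
    rw [apply_sharp, key _ hζ _ (sharp_time ξ), key _ hξ _ (sharp_time ζ), hH, sub_self]
  finrank_eq := by
    let E := EuclideanSpace ℝ (Fin n)
    let G : E × E →L[ℝ] ℝ × (E × E) →L[ℝ] ℝ := H ∘L ContinuousLinearMap.inr ℝ ℝ (E × E)
    let P : (E →L[ℝ] ℝ × (E × E)) → (E × E →ₗ[ℝ] (E →L[ℝ] ℝ)) := fun j =>
      { toFun := fun x => G x ∘L j
        map_add' := fun x y => by rw [map_add, ContinuousLinearMap.add_comp]
        map_smul' := fun c x => by rw [map_smul, ContinuousLinearMap.smul_comp]; rfl }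
    -- `f` sends `(q, q̇)` to the vector of `T` with `t = 0` over it.
    let f : E × E →ₗ[ℝ] DoubleModel n := (0 : E × E →ₗ[ℝ] ℝ).prod
      (((LinearMap.fst ℝ E E).prod
          (P (ContinuousLinearMap.inr ℝ ℝ _ ∘L ContinuousLinearMap.inr ℝ _ _))).prod
        ((LinearMap.snd ℝ E E).prod
          (P (ContinuousLinearMap.inr ℝ ℝ _ ∘L ContinuousLinearMap.inl ℝ _ _))))
    have hf : Function.Injective f := fun x y h =>
      Prod.ext (congrArg (fun w : DoubleModel n => w.2.1.1) h)
        (congrArg (fun w : DoubleModel n => w.2.2.1) h)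
    have hr : T ⊓ LinearMap.range (sharp n) = LinearMap.range f := by
      ext w
      rw [Submodule.mem_inf, mem_range_sharp, hT]
      constructor
      · rintro ⟨⟨h1, h2⟩, h0⟩
        have hj : jetProj E w = (0, (w.2.1.1, w.2.2.1)) := Prod.ext h0 rfl
        rw [hj] at h1 h2
        exact ⟨(w.2.1.1, w.2.2.1),
          Prod.ext h0.symm (Prod.ext (Prod.ext rfl h1.symm) (Prod.ext rfl h2.symm))⟩
      · rintro ⟨x, rfl⟩
        exact ⟨⟨rfl, rfl⟩, rfl⟩
    rw [finrank_range_sharp, hr, LinearMap.finrank_range_of_inj hf, Module.finrank_prod,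
      finrank_euclideanSpace_fin]
    ring

end DoubleModel

theorem AdaptedChart.isLagrangian_ker_fderiv_elEquations {n : ℕ} {M : Type*} [TopologicalSpace M]
    [ChartedSpace (ℝ × EuclideanSpace ℝ (Fin n)) M]
    [IsManifold 𝓘(ℝ, ℝ × EuclideanSpace ℝ (Fin n)) ∞ M]
    {π : Fibration (EuclideanSpace ℝ (Fin n)) M} (a : AdaptedChart π) {L : Jet π → ℝ}
    (hL : ContMDiff 𝓘(ℝ, ℝ × (EuclideanSpace ℝ (Fin n) × EuclideanSpace ℝ (Fin n))) 𝓘(ℝ, ℝ) ∞ L)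
    {p : DoubleModel n} (hp : p ∈ a.dual.jet.chart.target) :
    IsLagrangian (DoubleModel.sharp n)
      (LinearMap.ker (fderiv ℝ (a.elEquations L) p).toLinearMap) := by
  refine DoubleModel.isLagrangian_of_symm _
    (fun u v => (a.isSymmSndFDerivAt_localLagrangian hL (a.jetProj_mem_target hp)).eq u v) fun w => ?_
  rw [LinearMap.mem_ker]
  change fderiv ℝ (a.elEquations L) p w = 0 ↔ _
  rw [a.fderiv_elEquations hL hp, Prod.mk_eq_zero, sub_eq_zero, sub_eq_zero]

end Tulczyjew

open Tulczyjew
theorem mainTheorem7 {n : ℕ} {M : Type*} [TopologicalSpace M]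
    [ChartedSpace (ℝ × EuclideanSpace ℝ (Fin n)) M]
    [IsManifold 𝓘(ℝ, ℝ × EuclideanSpace ℝ (Fin n)) ∞ M]
    (π : Fibration (EuclideanSpace ℝ (Fin n)) M) (L : Jet π → ℝ)
    (hL : ContMDiff 𝓘(ℝ, ℝ × (EuclideanSpace ℝ (Fin n) × EuclideanSpace ℝ (Fin n))) 𝓘(ℝ, ℝ) ∞ L) :
    (∀ σ : LocalSection π, IsEulerLagrangeSolution L σ ↔
      ∀ t ∈ σ.dom, (tulczyjew π).symm (dTilde L (σ.j1 t)) = (σ.leg L hL).j1 t) ∧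
    (∀ a : AdaptedChart π,
      ContDiffOn ℝ ∞ (a.elEquations L) a.dual.jet.chart.target ∧
      (∀ p ∈ a.dual.jet.chart.target, Function.Surjective (fderiv ℝ (a.elEquations L) p)) ∧
      ∀ z ∈ a.dual.jet.chart.source,
        (z ∈ SL L ↔ a.elEquations L (a.dual.jet.chart z) = 0) ∧
        (z ∈ SL L → IsLagrangian (DoubleModel.sharp n)
          (LinearMap.ker (fderiv ℝ (a.elEquations L) (a.dual.jet.chart z)).toLinearMap))) ∧
    (∀ τ : LocalSection π.dual, (∀ t ∈ τ.dom, τ.j1 t ∈ SL L) ↔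
      IsEulerLagrangeSolution L τ.base ∧ ∀ t ∈ τ.dom, τ t = (τ.base.leg L hL) t) := by
  refine ⟨fun σ => ?_, fun a => ⟨a.contDiffOn_elEquations hL,
    fun p hp => a.fderiv_elEquations_surjective hL hp, fun z hz =>
      ⟨a.mem_SL_iff_elEquations hL hz, fun _ =>
        a.isLagrangian_ker_fderiv_elEquations hL (a.dual.jet.chart.map_source hz)⟩⟩,
    fun τ => τ.forall_j1_mem_SL_iff hL⟩
  rw [isEulerLagrangeSolution_iff_leg_j1_mem_SL hL]
  exact forall₂_congr fun t ht => (tulczyjew_symm_dTilde_eq_leg_j1_iff hL σ ht).symm
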